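/- Let $\langle x,y\rangle=-x_0y_0+x_1y_1+x_2y_2$ on $\mathbb R^{2,1}=\mathbb R^3$, let $\mathbb H^2=\{x:\langle x,x\rangle=-1,\ x_0>0\}$ be the hyperbolic plane, with distance given by $\cosh d(p,q)=-\langle p,q\rangle$, and let $\mathfrak{so}(2,1)$ be the space of linear maps $A$ of $\mathbb R^{2,1}$ with $\langle Ax,y\rangle+\langle x,Ay\rangle=0$ for all $x,y$. Let $S=\Gamma\backslash\mathbb H^2$ be a closed hyperbolic surface, where $\Gamma$ is a group of linear isometries of $\mathbb R^{2,1}$ that preserve $\mathbb H^2$, acting on $\mathbb H^2$ freely, properly discontinuously and cocompactly. Take a finite geodesic triangulation of $S$ (loops and multiple edges are allowed), lifted to a $\Gamma$-invariant geodesic triangulation of $\mathbb H^2$ with vertex set $V\subset\mathbb H^2$. Suppose that it is Delaunay: whenever $ijk$ and $ijl$ are the two lifted triangles adjacent to an edge $ij$, the vertex $l$ does not lie strictly inside the circumcycle (circle, horocycle or hypercycle) through $i,j,k$. An infinitesimal deformation of the circle pattern (the pattern of these circumcycles, which is determined by the vertices) within the hyperbolic (Fuchsian) slice is a map $\xi:V\to\mathbb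 R^{2,1}$ with $\langle v,\xi_v\rangle=0$ for all $v\in V$, such that for every $\gamma\in\Gamma$ there is $A_\gamma\in\mathfrak{so}(2,1)$ with $\xi_{\gamma v}=\gamma\,\xi_v+A_\gamma\gamma v$ for all $v\in V$; that is, the vertices move in $\mathbb H^2$, equivariantly to first order under an infinitesimal deformation of the holonomy in the isometry group of $\mathbb H^2$. It is conformal if, for every smooth motion $t\mapsto v(t)\in\mathbb H^2$ of the vertices with $v(0)=v$ and $\dot v(0)=\xi_v$, and for every edge $ij$ with adjacent triangles $ijk$, $ijl$, the length cross-ratio $$\frac{\sinh\frac{\lambda_{ik}}2\,\sinh\frac{\lambda_{jl}}2}{\sinh\frac{\lambda_{il}}2\,\sinh\frac{\lambda_{jk}}2},\qquad \lambda_{ab}=d(a(t),b(t)),$$ has derivative $0$ at $t=0$. Then every such conformal infinitesimal deformation $\xi$ is trivial: there is $A\in\mathfrak{so}(2,1)$ with $\xi_v=Av$ for all $v\in V$. -/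

import Mathlib

/-! Hyperbolic geometry in the hyperboloid model, closed hyperbolic surfaces as quotients of the
hyperbolic plane, their geodesic and Delaunay triangulations, and infinitesimal deformations of
the associated circle patterns. -/

namespace HypCircle

/-- The underlying vector space of Minkowski space `ℝ^{2,1}`. -/
abbrev Mink : Type := Fin 3 → ℝ

/-- The Minkowski inner product of signature `(2,1)`. -/
def minkInner (x y : Mink) : ℝ := -(x 0 * y 0) + x 1 * y 1 + x 2 * y 2

/-- The hyperbolic plane: the sheet `x₀ > 0` of the hyperboloid `⟨x, x⟩ = -1`. -/
def hyperbolicPlane : Set Mink := {x | minkInner x x = -1 ∧ 0 < x 0}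

/-- The hyperbolic distance, `⟨p, q⟩ = -cosh (hypDist p q)`. -/
noncomputable def hypDist (p q : Mink) : ℝ := Real.arcosh (-minkInner p q)

/-- The linear automorphisms of Minkowski space that restrict to isometries of the hyperbolic
plane: they preserve the inner product and the sheet `x₀ > 0`. -/
def IsHypIsometry (γ : Mink ≃ₗ[ℝ] Mink) : Prop :=
  (∀ x y, minkInner (γ x) (γ y) = minkInner x y) ∧ ∀ x ∈ hyperbolicPlane, γ x ∈ hyperbolicPlane

/-- The Lie algebra of the isometry group: `A` is skew for the Minkowski inner product. The vector
field `p ↦ A p` on the hyperbolic plane is the velocity field of a one-parameter group of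
isometries. -/
def IsInfHypIsometry (A : Mink →ₗ[ℝ] Mink) : Prop :=
  ∀ x y, minkInner (A x) y + minkInner x (A y) = 0

/-- A closed hyperbolic surface, presented as the quotient of the hyperbolic plane by a group of
isometries that acts freely, properly discontinuously and cocompactly. -/
structure ClosedHyperbolicSurface where
  Γ : Subgroup (Mink ≃ₗ[ℝ] Mink)
  isometric : ∀ γ ∈ Γ, IsHypIsometry γ
  free : ∀ γ ∈ Γ, ∀ x ∈ hyperbolicPlane, γ x = x → γ = 1
  properlyDiscontinuous : ∀ K : Set Mink, IsCompact K → K ⊆ hyperbolicPlane →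
    {γ : Mink ≃ₗ[ℝ] Mink | γ ∈ Γ ∧ ((γ '' K) ∩ K).Nonempty}.Finite
  cocompact : ∃ K : Set Mink, IsCompact K ∧ K ⊆ hyperbolicPlane ∧
    ∀ x ∈ hyperbolicPlane, ∃ γ ∈ Γ, γ x ∈ K

/-- The geodesic convex hull of finitely many points of the hyperbolic plane: the central
projection to the hyperboloid of their affine convex hull. For one, two or three independent
points it is the point, the geodesic segment, the geodesic triangle; it is empty for no points. -/
def geodesicHull (s : Finset Mink) : Set Mink :=
  {x | x ∈ hyperbolicPlane ∧ ∃ w : Mink → ℝ, (∀ v ∈ s, 0 ≤ w v) ∧ x = ∑ v ∈ s, w v • v}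

/-- A (finite) geodesic triangulation of the closed hyperbolic surface `S`, given by its lift to
the hyperbolic plane: a `Γ`-invariant set of nondegenerate geodesic triangles, finite modulo `Γ`,
which cover the plane, any two of them meeting in the hull of their common vertices (nothing, a
common vertex, a common edge). In the surface, edges may be loops and may have the same
end points. -/
structure GeodesicTriangulation (S : ClosedHyperbolicSurface) where
  /-- The vertex sets of the triangles. -/
  faces : Set (Finset Mink)
  mem_plane : ∀ f ∈ faces, ∀ v ∈ f, v ∈ hyperbolicPlane
  card_eq_three : ∀ f ∈ faces, f.card = 3
  nondegenerate : ∀ f ∈ faces, LinearIndependent ℝ (fun v : {v // v ∈ f} => (v : Mink))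
  covers : ∀ x ∈ hyperbolicPlane, ∃ f ∈ faces, x ∈ geodesicHull f
  inter_eq : ∀ f ∈ faces, ∀ g ∈ faces,
    geodesicHull f ∩ geodesicHull g = geodesicHull (f ∩ g)
  invariant : ∀ γ ∈ S.Γ, ∀ f ∈ faces, f.image γ ∈ faces
  finite_mod : ∃ F₀ : Finset (Finset Mink), ∀ f ∈ faces, ∃ γ ∈ S.Γ, ∃ f₀ ∈ F₀, f = f₀.image γ

namespace GeodesicTriangulation

variable {S : ClosedHyperbolicSurface}

/-- The lifted vertices. -/
def vertices (T : GeodesicTriangulation S) : Set Mink := {v | ∃ f ∈ T.faces, v ∈ f}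

/-- `ij` is an edge and `ijk`, `ijl` are the two triangles adjacent to it. -/
def Adjacent (T : GeodesicTriangulation S) (i j k l : Mink) : Prop :=
  ({i, j, k} : Finset Mink) ∈ T.faces ∧ ({i, j, l} : Finset Mink) ∈ T.faces ∧ k ≠ l

end GeodesicTriangulation

/-- `x` lies strictly inside the circumcycle (circle, horocycle or hypercycle) of the triangle
`ijk`. The circumcycle is the section of the hyperboloid by the affine plane through `i`, `j`, `k`,
whose equation is `⟨y, o⟩ = -1` for a multiple `o` of the centre; its inside is the side of that
plane which holds the geodesic triangle (for a circle of radius `r` with centre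
`o' = (cosh r) • o` in the hyperbolic plane, the points at distance less than `r` from `o'`). -/
def InsideCircumcycle (i j k x : Mink) : Prop :=
  ∃ o : Mink, minkInner i o = -1 ∧ minkInner j o = -1 ∧ minkInner k o = -1 ∧ -1 < minkInner x o

/-- The triangulation is Delaunay: no circumcycle of a triangle has the opposite vertex of an
adjacent triangle inside. -/
def GeodesicTriangulation.IsDelaunay {S : ClosedHyperbolicSurface}
    (T : GeodesicTriangulation S) : Prop :=
  ∀ i j k l, T.Adjacent i j k l → ¬ InsideCircumcycle i j k l

/-- The length cross-ratio of four points of the hyperbolic plane. -/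
noncomputable def lcr (p₁ p₂ p₃ p₄ : Mink) : ℝ :=
  (Real.sinh (hypDist p₁ p₃ / 2) * Real.sinh (hypDist p₂ p₄ / 2)) /
    (Real.sinh (hypDist p₁ p₄ / 2) * Real.sinh (hypDist p₂ p₃ / 2))

/-- An infinitesimal deformation, within the hyperbolic (Fuchsian) slice, of the circle pattern
of `T` (which is determined by the vertices): velocities `ξ v`, tangent to the hyperbolic plane,
of the lifted vertices `v`, which are equivariant to first order under an infinitesimal
deformation of the holonomy in the isometry group of the hyperbolic plane. If the vertices move as
`v(t)` and the holonomy of `γ` as `γ(t)`, the relation below is the derivative at `t = 0` of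
`(γ v)(t) = γ(t) (v(t))`, with `A = γ'(0) ∘ γ⁻¹`; hence `A` depends on `γ` and not on `v`.
Only the values of `ξ` at the vertices matter. -/
structure IsInfDeformation {S : ClosedHyperbolicSurface} (T : GeodesicTriangulation S)
    (ξ : Mink → Mink) : Prop where
  tangent : ∀ v ∈ T.vertices, minkInner v (ξ v) = 0
  equivariant : ∀ γ ∈ S.Γ, ∃ A : Mink →ₗ[ℝ] Mink, IsInfHypIsometry A ∧
    ∀ v ∈ T.vertices, ξ (γ v) = γ (ξ v) + A (γ v)

/-- `ξ` is conformal: under every smooth motion of the vertices in the hyperbolic plane with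
initial velocities `ξ`, the length cross-ratios of all edges are constant to first order. -/
def IsInfConformal {S : ClosedHyperbolicSurface} (T : GeodesicTriangulation S)
    (ξ : Mink → Mink) : Prop :=
  ∀ c : Mink → ℝ → Mink,
    (∀ v ∈ T.vertices, ContDiff ℝ (⊤ : ℕ∞) (c v) ∧ (∀ t, c v t ∈ hyperbolicPlane) ∧
      c v 0 = v ∧ HasDerivAt (c v) (ξ v) 0) →
    ∀ i j k l, T.Adjacent i j k l →
      HasDerivAt (fun t => lcr (c i t) (c j t) (c k t) (c l t)) 0 0

/-- `ξ` is trivial: it is induced by a global infinitesimal isometry of the hyperbolic plane. -/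
def IsTrivialDeformation {S : ClosedHyperbolicSurface} (T : GeodesicTriangulation S)
    (ξ : Mink → Mink) : Prop :=
  ∃ A : Mink →ₗ[ℝ] Mink, IsInfHypIsometry A ∧ ∀ v ∈ T.vertices, ξ v = A v

end HypCircle

/-! To first order each lifted triangle moves by an infinitesimal Möbius transformation: the field x
↦ ⟨a,x⟩x + a + w×x, tangent to the hyperbolic plane, with a = `transVec` and w = `rotVec` fitted to
the velocities of the three vertices (`velocity_eq`). Its conformal factor at a vertex v is u =
⟨a,v⟩, which is `scale`; its rotation speed there is ⟨w,v⟩ up to sign. Linearised, the cross-ratio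
condition makes u at i and at j agree in the two triangles adjacent to ij (`scale_opp`).

Around a vertex the jumps of the rotation speed from triangle to triangle cancel, because the angle
sum stays constant. Hence these jumps, multiplied by u and summed over the surface, total zero. The
fields of two adjacent triangles agree at both ends of their common edge, which expresses each jump
by the translational parts (`jump_relations`), so by `edgeFlux`, a quadratic form in the u's.
Regrouped by triangles (`edgeFlux_sum`), the vanishing total becomes a sum over edges of weight
times energy. The energy is positive definite in the two values of u at the ends, and the weight,
added over both adjacent triangles, is nonnegative by the Delaunay condition (`edgeWeight_add`). So
every term is zero (`weight_mul_energy_eq_zero`): u vanishes at the ends of each edge of nonzero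
weight.

An edge of zero weight separates two triangles with the same circumcycle. If u were nonzero at i,
turning around i would meet only such edges, and i and its neighbours would lie on one cycle. But
the triangles surround i, so no neighbour can be extreme along that cycle (`scale_eq_zero`). Hence u
= 0 and a = 0: each triangle moves by an infinitesimal isometry w×x. Two triangles with a common
edge have the same w, and the dual graph is connected (`face_induction`).

That each edge has exactly two triangles, on opposite sides, is derived from the covering and
intersection axioms (`IsFlag.exists_opposite`, `IsFlag.eq_of_same_side`). -/

namespace HypCircle

open Filter Topology

/-! ### Lorentzian vector algebra in `ℝ^{2,1}`. -/

section Algebra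

lemma minkInner_comm (x y : Mink) : minkInner x y = minkInner y x := by
  simp only [minkInner]; ring

lemma minkInner_add_left (x y z : Mink) :
    minkInner (x + y) z = minkInner x z + minkInner y z := by
  simp only [minkInner, Pi.add_apply]; ring

lemma minkInner_add_right (x y z : Mink) :
    minkInner x (y + z) = minkInner x y + minkInner x z := by
  simp only [minkInner, Pi.add_apply]; ring

lemma minkInner_sub_left (x y z : Mink) :
    minkInner (x - y) z = minkInner x z - minkInner y z := by
  simp only [minkInner, Pi.sub_apply]; ring

lemma minkInner_sub_right (x y z : Mink) :
    minkInner x (y - z) = minkInner x y - minkInner x z := by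
  simp only [minkInner, Pi.sub_apply]; ring

lemma minkInner_smul_left (a : ℝ) (x y : Mink) : minkInner (a • x) y = a * minkInner x y := by
  simp only [minkInner, Pi.smul_apply, smul_eq_mul]; ring

lemma minkInner_smul_right (a : ℝ) (x y : Mink) : minkInner x (a • y) = a * minkInner x y := by
  simp only [minkInner, Pi.smul_apply, smul_eq_mul]; ring

lemma minkInner_neg_right (x y : Mink) : minkInner x (-y) = -minkInner x y := by
  simp only [minkInner, Pi.neg_apply]; ring

lemma continuous_minkInner : Continuous fun z : Mink × Mink => minkInner z.1 z.2 := by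
  unfold minkInner; fun_prop

/-- The Lorentzian cross product. -/
def mcross (x y : Mink) : Mink :=
  ![-(x 1 * y 2 - x 2 * y 1), x 2 * y 0 - x 0 * y 2, x 0 * y 1 - x 1 * y 0]

@[simp] lemma mcross_zero (x y : Mink) : mcross x y 0 = -(x 1 * y 2 - x 2 * y 1) := rfl
@[simp] lemma mcross_one (x y : Mink) : mcross x y 1 = x 2 * y 0 - x 0 * y 2 := rfl
@[simp] lemma mcross_two (x y : Mink) : mcross x y 2 = x 0 * y 1 - x 1 * y 0 := rfl

/-- The determinant of three vectors. -/
def mdet (x y z : Mink) : ℝ := minkInner (mcross x y) z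

lemma mink_ext {x y : Mink} (h0 : x 0 = y 0) (h1 : x 1 = y 1) (h2 : x 2 = y 2) : x = y := by
  ext i; fin_cases i <;> assumption

lemma minkInner_mcross_mcross (a b c d : Mink) :
    minkInner (mcross a b) (mcross c d) =
      -(minkInner a c * minkInner b d - minkInner a d * minkInner b c) := by
  simp only [minkInner, mcross_zero, mcross_one, mcross_two]; ring

lemma minkInner_mcross (x y z : Mink) : minkInner (mcross x y) z = mdet x y z := rfl

lemma minkInner_mcross' (x y z : Mink) : minkInner z (mcross x y) = mdet x y z :=
  minkInner_comm _ _

lemma mdet_rotate (x y z : Mink) : mdet y z x = mdet x y z := by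
  simp only [mdet, minkInner, mcross_zero, mcross_one, mcross_two]; ring

lemma mdet_swap (x y z : Mink) : mdet x z y = -mdet x y z := by
  simp only [mdet, minkInner, mcross_zero, mcross_one, mcross_two]; ring

lemma mdet_swap' (x y z : Mink) : mdet y x z = -mdet x y z := by
  simp only [mdet, minkInner, mcross_zero, mcross_one, mcross_two]; ring

lemma mdet_self_left (x y : Mink) : mdet x y x = 0 := by
  simp only [mdet, minkInner, mcross_zero, mcross_one, mcross_two]; ring

lemma mdet_self_right (x y : Mink) : mdet x y y = 0 := by
  simp only [mdet, minkInner, mcross_zero, mcross_one, mcross_two]; ring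

lemma mdet_comb (i j a b c : Mink) (α β γ : ℝ) :
    mdet i j (α • a + β • b + γ • c) = α * mdet i j a + β * mdet i j b + γ * mdet i j c := by
  simp only [mdet, minkInner_add_right, minkInner_smul_right]

lemma mdet_sq (x y z : Mink) : mdet x y z ^ 2 =
    -(minkInner x x * (minkInner y y * minkInner z z - minkInner y z ^ 2)
      - minkInner x y * (minkInner x y * minkInner z z - minkInner y z * minkInner x z)
      + minkInner x z * (minkInner x y * minkInner y z - minkInner y y * minkInner x z)) := by
  simp only [mdet, minkInner, mcross_zero, mcross_one, mcross_two]; ring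

/-- The cross products of pairs form, up to the determinant, the basis dual to `i`, `j`, `k`. -/
lemma mdet_smul_eq_dual (i j k x : Mink) : mdet i j k • x =
    minkInner x i • mcross j k + minkInner x j • mcross k i + minkInner x k • mcross i j := by
  apply mink_ext <;>
  simp only [mdet, minkInner, mcross_zero, mcross_one, mcross_two, Pi.add_apply, Pi.smul_apply,
    smul_eq_mul] <;> ring

lemma mdet_smul_eq (i j k x : Mink) : mdet i j k • x =
    mdet x j k • i + mdet i x k • j + mdet i j x • k := by
  apply mink_ext <;>
  simp only [mdet, minkInner, mcross_zero, mcross_one, mcross_two, Pi.add_apply, Pi.smul_apply,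
    smul_eq_mul] <;> ring

lemma eq_zero_of_minkInner {i j k x : Mink} (hD : mdet i j k ≠ 0) (hi : minkInner x i = 0)
    (hj : minkInner x j = 0) (hk : minkInner x k = 0) : x = 0 := by
  have h := mdet_smul_eq_dual i j k x
  rw [hi, hj, hk] at h
  simpa [hD] using h

lemma comb_unique {i j k : Mink} (hD : mdet i j k ≠ 0) {a b c a' b' c' : ℝ}
    (h : a • i + b • j + c • k = a' • i + b' • j + c' • k) : a = a' ∧ b = b' ∧ c = c' := by
  have h1 := congrArg (mdet j k) h
  have h2 := congrArg (mdet k i) h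
  have h3 := congrArg (mdet i j) h
  simp only [mdet_comb, mdet_self_left, mdet_self_right, mdet_rotate] at h1 h2 h3
  rw [← mdet_rotate] at h2
  simp only [mul_zero, add_zero, zero_add] at h1 h2 h3
  rw [mdet_rotate] at h2
  exact ⟨mul_right_cancel₀ hD h1, mul_right_cancel₀ hD h2, mul_right_cancel₀ hD h3⟩

lemma mem_hyp_self {x : Mink} (h : x ∈ hyperbolicPlane) : minkInner x x = -1 := h.1

/-- Reversed Cauchy–Schwarz: x₀²y₀² − (1 + x₁y₁ + x₂y₂)² is the sum of the squares of x₁ − y₁, x₂ −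
y₂ and x₁y₂ − x₂y₁. -/
lemma minkInner_le_neg_one {x y : Mink} (hx : x ∈ hyperbolicPlane) (hy : y ∈ hyperbolicPlane) :
    minkInner x y ≤ -1 := by
  obtain ⟨hx, hx0⟩ := hx
  obtain ⟨hy, hy0⟩ := hy
  simp only [minkInner] at *
  have h : (1 + x 1 * y 1 + x 2 * y 2) ≤ x 0 * y 0 := by
    have hx2 : x 0 ^ 2 = 1 + x 1 ^ 2 + x 2 ^ 2 := by linarith
    have hy2 : y 0 ^ 2 = 1 + y 1 ^ 2 + y 2 ^ 2 := by linarith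
    refine le_of_abs_le (abs_le_of_sq_le_sq ?_ (mul_pos hx0 hy0).le)
    rw [mul_pow, hx2, hy2]
    nlinarith [sq_nonneg (x 1 - y 1), sq_nonneg (x 2 - y 2), sq_nonneg (x 1 * y 2 - x 2 * y 1)]
  linarith

lemma eq_of_minkInner_eq {x y : Mink} (hx : x ∈ hyperbolicPlane) (hy : y ∈ hyperbolicPlane)
    (h : minkInner x y = -1) : x = y := by
  obtain ⟨hx, hx0⟩ := hx
  obtain ⟨hy, hy0⟩ := hy
  simp only [minkInner] at *
  have h1 : x 0 ^ 2 * y 0 ^ 2 = (1 + x 1 * y 1 + x 2 * y 2) ^ 2 := by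
    rw [← mul_pow]; congr 1; linarith
  have hx2 : x 0 ^ 2 = 1 + x 1 ^ 2 + x 2 ^ 2 := by linarith
  have hy2 : y 0 ^ 2 = 1 + y 1 ^ 2 + y 2 ^ 2 := by linarith
  rw [hx2, hy2] at h1
  have h2 : (x 1 - y 1) ^ 2 + (x 2 - y 2) ^ 2 + (x 1 * y 2 - x 2 * y 1) ^ 2 = 0 := by
    linear_combination h1
  have e1 : x 1 = y 1 := by
    have : (x 1 - y 1) ^ 2 = 0 := by
      linarith [sq_nonneg (x 1 - y 1), sq_nonneg (x 2 - y 2), sq_nonneg (x 1 * y 2 - x 2 * y 1)]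
    exact sub_eq_zero.1 ((pow_eq_zero_iff two_ne_zero).1 this)
  have e2 : x 2 = y 2 := by
    have : (x 2 - y 2) ^ 2 = 0 := by
      linarith [sq_nonneg (x 1 - y 1), sq_nonneg (x 2 - y 2), sq_nonneg (x 1 * y 2 - x 2 * y 1)]
    exact sub_eq_zero.1 ((pow_eq_zero_iff two_ne_zero).1 this)
  refine mink_ext ?_ e1 e2
  have : x 0 ^ 2 = y 0 ^ 2 := by rw [hx2, hy2, e1, e2]
  exact (pow_left_inj₀ hx0.le hy0.le two_ne_zero).1 this

lemma minkInner_lt_neg_one {x y : Mink} (hx : x ∈ hyperbolicPlane) (hy : y ∈ hyperbolicPlane)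
    (h : x ≠ y) : minkInner x y < -1 :=
  lt_of_le_of_ne (minkInner_le_neg_one hx hy) fun e => h (eq_of_minkInner_eq hx hy e)

lemma exists_mdet_map (γ : Mink ≃ₗ[ℝ] Mink) : ∃ δ : ℝ, ∀ x y z,
    mdet (γ x) (γ y) (γ z) = δ * mdet x y z := by
  have hγ : ∀ x : Mink, γ x = x 0 • γ (Pi.single 0 1) + x 1 • γ (Pi.single 1 1)
      + x 2 • γ (Pi.single 2 1) := by
    intro x
    rw [← map_smul, ← map_smul, ← map_smul, ← map_add, ← map_add]
    congr 1
    apply mink_ext <;> simp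
  refine ⟨mdet (γ (Pi.single 0 1)) (γ (Pi.single 1 1)) (γ (Pi.single 2 1)), fun x y z => ?_⟩
  rw [hγ x, hγ y, hγ z]
  simp only [mdet, minkInner, mcross_zero, mcross_one, mcross_two, Pi.add_apply, Pi.smul_apply,
    smul_eq_mul]
  ring

lemma IsHypIsometry.exists_mdet {γ : Mink ≃ₗ[ℝ] Mink} (h : IsHypIsometry γ) :
    ∃ δ : ℝ, δ ^ 2 = 1 ∧ ∀ x y z, mdet (γ x) (γ y) (γ z) = δ * mdet x y z := by
  obtain ⟨δ, hδ⟩ := exists_mdet_map γ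
  refine ⟨δ, ?_, hδ⟩
  have h1 := mdet_sq (γ (Pi.single 0 1)) (γ (Pi.single 1 1)) (γ (Pi.single 2 1))
  simp only [h.1] at h1
  rw [← mdet_sq, hδ, mul_pow] at h1
  have h2 : mdet (Pi.single 0 1) (Pi.single 1 1) (Pi.single 2 1) ^ 2 = 1 := by
    simp [mdet, minkInner]
  rwa [h2, mul_one] at h1

/-- The identification of so(2,1) with Minkowski space; the entries of `w` are read off from `A` on
the standard basis. -/
lemma IsInfHypIsometry.exists_mcross {A : Mink →ₗ[ℝ] Mink} (h : IsInfHypIsometry A) :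
    ∃ w, ∀ x, A x = mcross w x := by
  have hA : ∀ x : Mink, A x = x 0 • A (Pi.single 0 1) + x 1 • A (Pi.single 1 1)
      + x 2 • A (Pi.single 2 1) := by
    intro x
    rw [← map_smul, ← map_smul, ← map_smul, ← map_add, ← map_add]
    congr 1
    apply mink_ext <;> simp
  have h00 := h (Pi.single 0 1) (Pi.single 0 1)
  have h11 := h (Pi.single 1 1) (Pi.single 1 1)
  have h22 := h (Pi.single 2 1) (Pi.single 2 1)
  have h01 := h (Pi.single 0 1) (Pi.single 1 1)
  have h02 := h (Pi.single 0 1) (Pi.single 2 1)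
  have h12 := h (Pi.single 1 1) (Pi.single 2 1)
  simp [minkInner] at h00 h11 h22 h01 h02 h12
  refine ⟨![A (Pi.single 1 1) 2, -A (Pi.single 0 1) 2, A (Pi.single 0 1) 1], fun x => ?_⟩
  rw [hA x]
  apply mink_ext <;>
  simp [h00, h11, h22]
  · linear_combination (-x 1) * h01 - x 2 * h02
  · linear_combination x 2 * h12
  · ring

/-- The infinitesimal isometry `x ↦ w × x`. -/
def mcrossLin (w : Mink) : Mink →ₗ[ℝ] Mink where
  toFun := mcross w
  map_add' x y := by
    apply mink_ext <;> simp only [mcross_zero, mcross_one, mcross_two, Pi.add_apply] <;> ring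
  map_smul' c x := by
    apply mink_ext <;> simp only [mcross_zero, mcross_one, mcross_two, Pi.smul_apply, smul_eq_mul,
      RingHom.id_apply] <;> ring

lemma isInfHypIsometry_mcrossLin (w : Mink) : IsInfHypIsometry (mcrossLin w) := by
  intro x y
  change minkInner (mcross w x) y + minkInner x (mcross w y) = 0
  simp only [minkInner, mcross_zero, mcross_one, mcross_two]; ring

end Algebra

/-! ### Geodesic hulls. -/

section Hull

lemma one_le_of_mem {x : Mink} (hx : x ∈ hyperbolicPlane) : 1 ≤ x 0 := by
  obtain ⟨h, h0⟩ := hx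
  simp only [minkInner] at h
  nlinarith [sq_nonneg (x 1), sq_nonneg (x 2)]

lemma isClosed_hyperbolicPlane : IsClosed hyperbolicPlane := by
  have : hyperbolicPlane = {x : Mink | minkInner x x = -1} ∩ {x | 1 ≤ x 0} := by
    ext x
    exact ⟨fun h => ⟨h.1, one_le_of_mem h⟩, fun h => ⟨h.1, lt_of_lt_of_le one_pos h.2⟩⟩
  rw [this]
  refine (isClosed_eq ?_ continuous_const).inter (isClosed_le continuous_const ?_)
  · exact continuous_minkInner.comp (continuous_id.prodMk continuous_id)
  · exact continuous_apply 0

lemma minkInner_sum_left {ι : Type*} (s : Finset ι) (f : ι → Mink) (y : Mink) :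
    minkInner (∑ v ∈ s, f v) y = ∑ v ∈ s, minkInner (f v) y := by
  classical
  induction s using Finset.induction_on with
  | empty => simp [minkInner]
  | insert a s ha ih => rw [Finset.sum_insert ha, Finset.sum_insert ha, minkInner_add_left, ih]

lemma isCompact_geodesicHull {f : Finset Mink} (hf : ∀ v ∈ f, v ∈ hyperbolicPlane) :
    IsCompact (geodesicHull f) := by
  have hK : IsCompact (Set.pi Set.univ fun _ : Mink => Set.Icc (0 : ℝ) 1) :=
    isCompact_univ_pi fun _ => isCompact_Icc
  have hL : Continuous fun w : Mink → ℝ => ∑ v ∈ f, w v • v :=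
    continuous_finsetSum _ fun v _ => (continuous_apply v).smul continuous_const
  have : geodesicHull f = (fun w : Mink → ℝ => ∑ v ∈ f, w v • v) ''
      (Set.pi Set.univ fun _ : Mink => Set.Icc (0 : ℝ) 1) ∩ hyperbolicPlane := by
    ext x
    constructor
    · rintro ⟨hx, w, hw, rfl⟩
      -- The cube is indexed by all of `Mink`, so the irrelevant weights off `f` are set to 0.
      refine ⟨⟨fun v => if v ∈ f then w v else 0, ?_, ?_⟩, hx⟩
      · intro v _
        by_cases hv : v ∈ f
        · simp only [hv, if_true]
          refine ⟨hw v hv, ?_⟩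
          have h1 := mem_hyp_self hx
          nth_rewrite 1 [minkInner_sum_left] at h1
          have h2 : ∑ u ∈ f, w u ≤ 1 := by
            -- Pairing x with itself gives −1 = Σ w_u⟨u,x⟩ ≤ −Σ w_u, which bounds the weights.
            have h3 : ∑ u ∈ f, minkInner (w u • u) (∑ v ∈ f, w v • v) ≤ ∑ u ∈ f, -w u := by
              refine Finset.sum_le_sum fun u hu => ?_
              rw [minkInner_smul_left]
              nlinarith [minkInner_le_neg_one (hf u hu) hx, hw u hu]
            rw [h1, Finset.sum_neg_distrib] at h3
            linarith
          exact (Finset.single_le_sum (f := w) (fun u hu => hw u hu) hv).trans h2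
        · simp [hv]
      · exact Finset.sum_congr rfl fun v hv => by simp [hv]
    · rintro ⟨⟨w, hw, rfl⟩, hx⟩
      exact ⟨hx, w, fun v _ => (hw v trivial).1, rfl⟩
  rw [this]
  exact (hK.image hL).inter_right isClosed_hyperbolicPlane

lemma geodesicHull_image {γ : Mink ≃ₗ[ℝ] Mink} (h : ∀ x ∈ hyperbolicPlane, γ x ∈ hyperbolicPlane)
    (f : Finset Mink) : γ '' geodesicHull f ⊆ geodesicHull (f.image γ) := by
  rintro _ ⟨x, ⟨hx, w, hw, rfl⟩, rfl⟩
  refine ⟨h _ hx, fun v => w (γ.symm v), ?_, ?_⟩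
  · intro v hv
    obtain ⟨u, hu, rfl⟩ := Finset.mem_image.1 hv
    simpa using hw u hu
  · rw [Finset.sum_image fun a _ b _ hab => γ.injective hab]
    simp [map_sum]

lemma mem_geodesicHull_triple {i j k : Mink} (hij : i ≠ j) (hik : i ≠ k) (hjk : j ≠ k) {x : Mink} :
    x ∈ geodesicHull {i, j, k} ↔ x ∈ hyperbolicPlane ∧ ∃ a b c : ℝ, 0 ≤ a ∧ 0 ≤ b ∧ 0 ≤ c ∧
      x = a • i + b • j + c • k := by
  have hs : ∀ w : Mink → ℝ, ∑ v ∈ ({i, j, k} : Finset Mink), w v • v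
      = w i • i + w j • j + w k • k := by
    intro w
    rw [Finset.sum_insert (by simp [hij, hik]), Finset.sum_insert (by simp [hjk]),
      Finset.sum_singleton, add_assoc]
  constructor
  · rintro ⟨hx, w, hw, rfl⟩
    exact ⟨hx, w i, w j, w k, hw _ (by simp), hw _ (by simp), hw _ (by simp), hs w⟩
  · rintro ⟨hx, a, b, c, ha, hb, hc, rfl⟩
    refine ⟨hx, fun v => if v = i then a else if v = j then b else c, ?_, ?_⟩
    · intro v _
      dsimp only
      split_ifs <;> assumption
    · rw [hs]
      simp [hij.symm, hik.symm, hjk.symm]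

end Hull

/-! ### Flags and local finiteness of the triangulation. -/

namespace GeodesicTriangulation

variable {S : ClosedHyperbolicSurface} (T : GeodesicTriangulation S)

/-- `i`, `j`, `k` are the vertices of a triangle, in some order. -/
def IsFlag (i j k : Mink) : Prop := ({i, j, k} : Finset Mink) ∈ T.faces

variable {T} {i j k l : Mink}

lemma IsFlag.swap (h : T.IsFlag i j k) : T.IsFlag j i k := by
  unfold IsFlag at *; rwa [Finset.insert_comm]

lemma IsFlag.swap' (h : T.IsFlag i j k) : T.IsFlag i k j := by
  unfold IsFlag at *; rwa [Finset.pair_comm]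

lemma IsFlag.rotate (h : T.IsFlag i j k) : T.IsFlag j k i := h.swap.swap'

lemma IsFlag.ne (h : T.IsFlag i j k) : i ≠ j := by
  rintro rfl
  have := T.card_eq_three _ h
  rw [Finset.insert_idem] at this
  have := Finset.card_le_two (a := i) (b := k)
  omega

lemma IsFlag.ne' (h : T.IsFlag i j k) : i ≠ k := h.swap'.ne

lemma IsFlag.ne'' (h : T.IsFlag i j k) : j ≠ k := h.rotate.ne

lemma IsFlag.mem (h : T.IsFlag i j k) : i ∈ hyperbolicPlane := T.mem_plane _ h i (by simp)

lemma IsFlag.mem' (h : T.IsFlag i j k) : j ∈ hyperbolicPlane := T.mem_plane _ h j (by simp)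

lemma IsFlag.mem'' (h : T.IsFlag i j k) : k ∈ hyperbolicPlane := T.mem_plane _ h k (by simp)

lemma IsFlag.vertex (h : T.IsFlag i j k) : i ∈ T.vertices := ⟨_, h, by simp⟩

lemma IsFlag.mdet_ne_zero (h : T.IsFlag i j k) : mdet i j k ≠ 0 := by
  have hl := T.nondegenerate _ h
  have h1 : LinearIndependent ℝ ![i, j, k] := by
    have := hl.comp (ι' := Fin 3) ![⟨i, by simp⟩, ⟨j, by simp⟩, ⟨k, by simp⟩] (by
      intro a b hab
      fin_cases a <;> fin_cases b <;> simp [h.ne, h.ne', h.ne'', h.ne.symm, h.ne'.symm,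
        h.ne''.symm] at hab ⊢)
    convert this using 1
    ext a : 1
    fin_cases a <;> rfl
  have h2 := Matrix.linearIndependent_rows_iff_isUnit (A := Matrix.of ![i, j, k]) |>.1 h1
  rw [Matrix.isUnit_iff_isUnit_det, isUnit_iff_ne_zero, Matrix.det_fin_three] at h2
  intro h0
  apply h2
  simp [mdet, minkInner] at h0 ⊢
  linear_combination h0

lemma exists_isFlag {f : Finset Mink} (hf : f ∈ T.faces) :
    ∃ i j k, f = {i, j, k} ∧ T.IsFlag i j k := by
  obtain ⟨i, j, k, -, -, -, rfl⟩ := Finset.card_eq_three.1 (T.card_eq_three f hf)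
  exact ⟨i, j, k, rfl, hf⟩

lemma exists_isFlag_of_mem {f : Finset Mink} (hf : f ∈ T.faces) (hi : i ∈ f) :
    ∃ j k, f = {i, j, k} ∧ T.IsFlag i j k := by
  obtain ⟨a, b, c, rfl, h⟩ := exists_isFlag hf
  simp only [Finset.mem_insert, Finset.mem_singleton] at hi
  rcases hi with rfl | rfl | rfl
  · exact ⟨b, c, rfl, h⟩
  · exact ⟨a, c, by rw [Finset.insert_comm], h.swap⟩
  · exact ⟨a, b, by rw [Finset.insert_comm, Finset.pair_comm, Finset.insert_comm,
      Finset.pair_comm, Finset.insert_comm, Finset.pair_comm], h.rotate.rotate⟩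

lemma exists_isFlag_of_mem_mem {f : Finset Mink} (hf : f ∈ T.faces) (hij : i ≠ j) (hi : i ∈ f)
    (hj : j ∈ f) : ∃ k, f = {i, j, k} ∧ T.IsFlag i j k := by
  obtain ⟨a, b, rfl, h⟩ := exists_isFlag_of_mem hf hi
  simp only [Finset.mem_insert, Finset.mem_singleton, hij.symm, false_or] at hj
  rcases hj with rfl | rfl
  · exact ⟨b, rfl, h⟩
  · exact ⟨a, by rw [Finset.pair_comm], h.swap'⟩

lemma exists_isFlag_of_vertex (hi : i ∈ T.vertices) : ∃ j k, T.IsFlag i j k := by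
  obtain ⟨f, hf, hif⟩ := hi
  obtain ⟨j, k, -, h⟩ := exists_isFlag_of_mem hf hif
  exact ⟨j, k, h⟩

lemma IsFlag.map {γ : Mink ≃ₗ[ℝ] Mink} (hγ : γ ∈ S.Γ) (h : T.IsFlag i j k) :
    T.IsFlag (γ i) (γ j) (γ k) := by
  have := T.invariant γ hγ _ h
  simpa only [IsFlag, Finset.image_insert, Finset.image_singleton] using this

lemma vertex_mem_plane (hi : i ∈ T.vertices) : i ∈ hyperbolicPlane := by
  obtain ⟨f, hf, hif⟩ := hi
  exact T.mem_plane f hf i hif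

lemma vertex_map {γ : Mink ≃ₗ[ℝ] Mink} (hγ : γ ∈ S.Γ) (hi : i ∈ T.vertices) :
    γ i ∈ T.vertices := by
  obtain ⟨j, k, h⟩ := exists_isFlag_of_vertex hi
  exact (h.map hγ).vertex

lemma isCompact_hull {f : Finset Mink} (hf : f ∈ T.faces) : IsCompact (geodesicHull f) :=
  isCompact_geodesicHull (T.mem_plane f hf)

variable (T) in
/-- The triangles meeting a compact subset of the plane are finite in number. -/
lemma finite_meeting {K : Set Mink} (hK : IsCompact K) (hKH : K ⊆ hyperbolicPlane) :
    {f ∈ T.faces | (geodesicHull f ∩ K).Nonempty}.Finite := by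
  classical
  obtain ⟨F₀, hF₀⟩ := T.finite_mod
  set F : Finset (Finset Mink) := F₀.filter fun f => f ∈ T.faces
  -- With the representative triangles added to `K`, a translate that meets `K` comes from a group
  -- element that moves `K'` to a set meeting `K'`; there are finitely many of those.
  set K' : Set Mink := K ∪ ⋃ f ∈ F, geodesicHull f
  have hK' : IsCompact K' := hK.union <| F.isCompact_biUnion fun f hf =>
    isCompact_hull (Finset.mem_filter.1 hf).2
  have hK'H : K' ⊆ hyperbolicPlane := by
    refine Set.union_subset hKH (Set.iUnion₂_subset fun f _ x hx => hx.1)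
  have hfin := S.properlyDiscontinuous K' hK' hK'H
  refine ((hfin.prod F.finite_toSet).image fun z => z.2.image z.1).subset ?_
  rintro f ⟨hf, x, hxf, hxK⟩
  obtain ⟨γ, hγ, f₀, hf₀, rfl⟩ := hF₀ f hf
  have hγ' : γ⁻¹ ∈ S.Γ := S.Γ.inv_mem hγ
  have e : (f₀.image γ).image (γ⁻¹ : Mink ≃ₗ[ℝ] Mink) = f₀ := by
    have h1 : (γ⁻¹ : Mink ≃ₗ[ℝ] Mink) ∘ γ = id := funext γ.symm_apply_apply
    rw [Finset.image_image, h1, Finset.image_id]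
  have hf₀T : f₀ ∈ F := by
    refine Finset.mem_filter.2 ⟨hf₀, ?_⟩
    rw [← e]
    exact T.invariant _ hγ' _ hf
  refine ⟨(γ, f₀), ⟨⟨hγ, x, ?_, Or.inl hxK⟩, hf₀T⟩, rfl⟩
  refine ⟨(γ⁻¹ : Mink ≃ₗ[ℝ] Mink) x, Or.inr ?_, γ.apply_symm_apply x⟩
  refine Set.mem_biUnion hf₀T ?_
  rw [← e]
  exact geodesicHull_image (S.isometric _ hγ').2 _ ⟨x, hxf, rfl⟩

lemma finite_star (hi : i ∈ T.vertices) : {f ∈ T.faces | i ∈ f}.Finite := by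
  have hiH := vertex_mem_plane hi
  refine (T.finite_meeting isCompact_singleton (Set.singleton_subset_iff.2 hiH)).subset ?_
  rintro f ⟨hf, hif⟩
  refine ⟨hf, i, ⟨hiH, fun v => if v = i then 1 else 0, ?_, ?_⟩, rfl⟩
  · intro v _
    dsimp only
    split_ifs <;> norm_num
  · simp [hif]

end GeodesicTriangulation

/-! ### Each edge has exactly two triangles, one on each side. -/

section Normalize

/-- The central projection of the future cone to the hyperboloid. -/
noncomputable def normalize (y : Mink) : Mink := (Real.sqrt (-minkInner y y))⁻¹ • y

lemma normalize_mem {y : Mink} (h : minkInner y y < 0) (h0 : 0 < y 0) :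
    normalize y ∈ hyperbolicPlane := by
  have hs : 0 < Real.sqrt (-minkInner y y) := Real.sqrt_pos.2 (by linarith)
  have h2 := Real.sq_sqrt (show 0 ≤ -minkInner y y by linarith)
  refine ⟨?_, ?_⟩
  · rw [normalize, minkInner_smul_left, minkInner_smul_right]
    field_simp
    linarith
  · simp only [normalize, Pi.smul_apply, smul_eq_mul]
    positivity

lemma continuous_minkInner_self : Continuous fun y : Mink => minkInner y y :=
  continuous_minkInner.comp (continuous_id.prodMk continuous_id)

lemma continuousAt_normalize {y : Mink} (h : minkInner y y < 0) : ContinuousAt normalize y := by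
  have hs : 0 < Real.sqrt (-minkInner y y) := Real.sqrt_pos.2 (by linarith)
  have h1 : ContinuousAt (fun y : Mink => Real.sqrt (-minkInner y y)) y :=
    (Real.continuous_sqrt.comp continuous_minkInner_self.neg).continuousAt
  exact (h1.inv₀ hs.ne').smul continuousAt_id

lemma minkInner_add_self_neg {x y : Mink} (hx : x ∈ hyperbolicPlane) (hy : y ∈ hyperbolicPlane) :
    minkInner (x + y) (x + y) < 0 := by
  rw [minkInner_add_left, minkInner_add_right, minkInner_add_right, minkInner_comm y x, hx.1, hy.1]
  linarith [minkInner_le_neg_one hx hy]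

lemma mdet_eq_zero_of_mem_geodesicHull {i j x : Mink} {s : Finset Mink} (hx : x ∈ geodesicHull s)
    (hs : ∀ v ∈ s, v = i ∨ v = j) : mdet i j x = 0 := by
  obtain ⟨-, w, -, rfl⟩ := hx
  rw [mdet, minkInner_comm, minkInner_sum_left]
  refine Finset.sum_eq_zero fun v hv => ?_
  rw [minkInner_smul_left, minkInner_comm, minkInner_mcross]
  rcases hs v hv with rfl | rfl
  · rw [mdet_self_left, mul_zero]
  · rw [mdet_self_right, mul_zero]

end Normalize

namespace GeodesicTriangulation

variable {S : ClosedHyperbolicSurface} {T : GeodesicTriangulation S} {i j k l : Mink}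

lemma IsFlag.mem_hull_iff (h : T.IsFlag i j k) {x : Mink} :
    x ∈ geodesicHull {i, j, k} ↔ x ∈ hyperbolicPlane ∧ ∃ a b c : ℝ, 0 ≤ a ∧ 0 ≤ b ∧ 0 ≤ c ∧
      x = a • i + b • j + c • k :=
  mem_geodesicHull_triple h.ne h.ne' h.ne''

/-- A point close to the edge, pushed slightly towards `k`, lies in both triangles. If `k ≠ l`,
their intersection would be contained in the geodesic through `i` and `j`. -/
lemma IsFlag.eq_of_same_side (hk : T.IsFlag i j k) (hl : T.IsFlag i j l)
    (h : 0 < mdet i j k * mdet i j l) : k = l := by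
  by_contra hkl
  have hD := hl.mdet_ne_zero
  set α := mdet k j l / mdet i j l with hα
  set β := mdet i k l / mdet i j l with hβ
  set γ := mdet i j k / mdet i j l with hγ
  have hk' : k = α • i + β • j + γ • l := by
    have := mdet_smul_eq i j l k
    rw [hα, hβ, hγ]
    simp only [div_eq_inv_mul, mul_smul, ← smul_add]
    rw [← this, inv_smul_smul₀ hD]
  have hγ0 : 0 < γ := by
    have : γ = mdet i j k * mdet i j l / mdet i j l ^ 2 := by rw [hγ]; field_simp
    rw [this]; positivity
  -- Small enough to keep the coefficients 1 + εα and 1 + εβ of i + j + εk in the basis `i`, `j`,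
  -- `l` nonnegative.
  set ε := (1 + |α| + |β|)⁻¹ with hε
  have hpos : 0 < 1 + |α| + |β| := by positivity
  have hε0 : 0 < ε := inv_pos.2 hpos
  have hε1 : ε * (1 + |α| + |β|) = 1 := inv_mul_cancel₀ hpos.ne'
  have hεα : 0 ≤ 1 + ε * α := by nlinarith [neg_abs_le α, abs_nonneg β]
  have hεβ : 0 ≤ 1 + ε * β := by nlinarith [neg_abs_le β, abs_nonneg α]
  set y := i + j + ε • k with hy
  have hyy : minkInner y y < 0 := by
    have h1 := minkInner_le_neg_one hk.mem hk.mem'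
    have h2 := minkInner_le_neg_one hk.mem hk.mem''
    have h3 := minkInner_le_neg_one hk.mem' hk.mem''
    rw [hy]
    simp only [minkInner_add_left, minkInner_add_right, minkInner_smul_left,
      minkInner_smul_right, minkInner_comm j i, minkInner_comm k i, minkInner_comm k j,
      hk.mem.1, hk.mem'.1, hk.mem''.1]
    nlinarith [mul_pos hε0 hε0, mul_nonneg hε0.le (neg_nonneg.2 (h2.trans (by norm_num))),
      mul_nonneg hε0.le (neg_nonneg.2 (h3.trans (by norm_num)))]
  have hy0 : 0 < y 0 := by
    have h1 := hk.mem.2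
    have h2 := hk.mem'.2
    have h3 := hk.mem''.2
    simp only [hy, Pi.add_apply, Pi.smul_apply, smul_eq_mul]
    positivity
  have hx := normalize_mem hyy hy0
  have ht : 0 < (Real.sqrt (-minkInner y y))⁻¹ := inv_pos.2 (Real.sqrt_pos.2 (by linarith))
  set t := (Real.sqrt (-minkInner y y))⁻¹ with htdef
  have hxy : normalize y = t • y := rfl
  have hm : normalize y ∈ geodesicHull {i, j, k} ∩ geodesicHull {i, j, l} := by
    rw [Set.mem_inter_iff, hk.mem_hull_iff, hl.mem_hull_iff]
    refine ⟨⟨hx, t, t, t * ε, ht.le, ht.le, by positivity, ?_⟩,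
      ⟨hx, t * (1 + ε * α), t * (1 + ε * β), t * (ε * γ), by positivity, by positivity,
        by positivity, ?_⟩⟩
    · rw [hxy, hy]; simp only [smul_add, smul_smul]
    · rw [hxy, hy]
      nth_rewrite 1 [hk']
      simp only [smul_add, smul_smul, mul_add, add_smul, mul_one]
      abel
  rw [T.inter_eq _ hk _ hl] at hm
  have h0 := mdet_eq_zero_of_mem_geodesicHull (i := i) (j := j) hm (by
    intro v hv
    simp only [Finset.mem_inter, Finset.mem_insert, Finset.mem_singleton] at hv
    rcases hv with ⟨rfl | rfl | rfl, h2⟩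
    · exact Or.inl rfl
    · exact Or.inr rfl
    · rcases h2 with h2 | h2 | h2
      · exact Or.inl h2
      · exact Or.inr h2
      · exact absurd h2 hkl)
  rw [hxy, hy, mdet, minkInner_smul_right, minkInner_add_right, minkInner_add_right,
    minkInner_smul_right, minkInner_mcross, minkInner_mcross, minkInner_mcross, mdet_self_left,
    mdet_self_right] at h0
  simp [ht.ne', hε0.ne', hk.mdet_ne_zero] at h0

/-- Leave the midpoint of the edge on the side away from `k`. By local finiteness, nearby points are
covered by triangles that contain the midpoint, and such a triangle must have `i` and `j` among its
vertices. -/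
lemma IsFlag.exists_opposite (h : T.IsFlag i j k) :
    ∃ l, T.IsFlag i j l ∧ mdet i j k * mdet i j l < 0 := by
  set y : ℝ → Mink := fun s => i + j + (-s) • k with hy
  have hyc : Continuous y := by fun_prop
  have hy0 : y 0 = i + j := by simp [hy]
  have hneg : minkInner (y 0) (y 0) < 0 := by
    rw [hy0]; exact minkInner_add_self_neg h.mem h.mem'
  have hpos : 0 < y 0 0 := by
    rw [hy0, Pi.add_apply]; exact add_pos h.mem.2 h.mem'.2
  set x : ℝ → Mink := fun s => normalize (y s) with hx
  have hxc : Tendsto x (𝓝[>] 0) (𝓝 (x 0)) :=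
    ((continuousAt_normalize hneg).comp (f := y) hyc.continuousAt).tendsto.mono_left
      nhdsWithin_le_nhds
  set K : Set Mink := Metric.closedBall (x 0) 1 ∩ hyperbolicPlane with hK
  have hKc : IsCompact K := (isCompact_closedBall _ _).inter_right isClosed_hyperbolicPlane
  have hfin := T.finite_meeting hKc Set.inter_subset_right
  -- The finitely many triangles near the midpoint that miss it have a closed union, which the
  -- moving point avoids for small s.
  set U : Set Mink := ⋃ g ∈ {g ∈ {f ∈ T.faces | (geodesicHull f ∩ K).Nonempty} |
    x 0 ∉ geodesicHull g}, geodesicHull g with hU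
  have hUc : IsClosed U := (hfin.subset (Set.sep_subset _ _)).isClosed_biUnion fun g hg =>
    (isCompact_hull hg.1.1).isClosed
  have hxU : x 0 ∉ U := by
    simp only [hU, Set.mem_iUnion, not_exists]
    exact fun g hg hxg => hg.2 hxg
  have e1 : ∀ᶠ s in 𝓝[>] (0 : ℝ), x s ∈ Uᶜ := hxc (hUc.isOpen_compl.mem_nhds hxU)
  have e2 : ∀ᶠ s in 𝓝[>] (0 : ℝ), x s ∈ Metric.closedBall (x 0) 1 :=
    hxc (Metric.closedBall_mem_nhds _ one_pos)
  have e3 : ∀ᶠ s in 𝓝[>] (0 : ℝ), minkInner (y s) (y s) < 0 :=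
    nhdsWithin_le_nhds ((continuous_minkInner_self.comp hyc).continuousAt.eventually_lt
      continuousAt_const hneg)
  have e4 : ∀ᶠ s in 𝓝[>] (0 : ℝ), 0 < y s 0 :=
    nhdsWithin_le_nhds (continuousAt_const.eventually_lt
      ((continuous_apply 0).comp hyc).continuousAt hpos)
  obtain ⟨s, h1, h2, h3, h4, hs⟩ := (e1.and (e2.and (e3.and (e4.and self_mem_nhdsWithin)))).exists
  have hs : 0 < s := hs
  have hxs : x s ∈ hyperbolicPlane := normalize_mem h3 h4
  obtain ⟨g, hg, hxg⟩ := T.covers _ hxs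
  have hx0 : x 0 ∈ geodesicHull g := by
    by_contra hn
    exact h1 (Set.mem_biUnion (⟨⟨hg, x s, hxg, h2, hxs⟩, hn⟩ : _ ∧ _) hxg)
  have hD := h.mdet_ne_zero
  have ht : ∀ r, minkInner (y r) (y r) < 0 → 0 < (Real.sqrt (-minkInner (y r) (y r)))⁻¹ :=
    fun r hr => inv_pos.2 (Real.sqrt_pos.2 (by linarith))
  have ht0 := ht 0 hneg
  have hts := ht s h3
  set t₀ := (Real.sqrt (-minkInner (y 0) (y 0)))⁻¹
  set t := (Real.sqrt (-minkInner (y s) (y s)))⁻¹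
  have hx0' : x 0 = t₀ • i + t₀ • j := by
    change t₀ • y 0 = _
    rw [hy0, smul_add]
  have hxs' : x s = t • i + t • j + (-(t * s)) • k := by
    change t • y s = _
    simp only [hy, smul_add, smul_smul, mul_neg]
  have hinter : x 0 ∈ geodesicHull (g ∩ {i, j, k}) := by
    rw [← T.inter_eq _ hg _ h]
    refine ⟨hx0, h.mem_hull_iff.2 ⟨normalize_mem hneg hpos, t₀, t₀, 0, ht0.le, ht0.le, le_rfl, ?_⟩⟩
    rw [hx0', zero_smul, add_zero]
  -- Otherwise the midpoint of `ij` would lie on the geodesic through `j` and `k`.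
  have hig : i ∈ g := by
    by_contra hn
    have h0 := mdet_eq_zero_of_mem_geodesicHull (i := j) (j := k) hinter (by
      intro v hv
      simp only [Finset.mem_inter, Finset.mem_insert, Finset.mem_singleton] at hv
      rcases hv with ⟨hvg, rfl | rfl | rfl⟩
      · exact absurd hvg hn
      · exact Or.inl rfl
      · exact Or.inr rfl)
    rw [hx0', mdet, minkInner_add_right, minkInner_smul_right, minkInner_smul_right,
      minkInner_mcross, minkInner_mcross, mdet_rotate, mdet_self_left] at h0
    simp [ht0.ne', hD] at h0
  have hjg : j ∈ g := by
    by_contra hn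
    have h0 := mdet_eq_zero_of_mem_geodesicHull (i := k) (j := i) hinter (by
      intro v hv
      simp only [Finset.mem_inter, Finset.mem_insert, Finset.mem_singleton] at hv
      rcases hv with ⟨hvg, rfl | rfl | rfl⟩
      · exact Or.inr rfl
      · exact absurd hvg hn
      · exact Or.inl rfl)
    rw [hx0', mdet, minkInner_add_right, minkInner_smul_right, minkInner_smul_right,
      minkInner_mcross, minkInner_mcross, mdet_self_right, ← mdet_rotate k i j] at h0
    simp [ht0.ne', hD] at h0
  obtain ⟨l, rfl, hl⟩ := exists_isFlag_of_mem_mem hg h.ne hig hjg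
  obtain ⟨-, a, b, c, -, -, hc, hxl⟩ := hl.mem_hull_iff.1 hxg
  have hm : c * mdet i j l = -(t * s) * mdet i j k := by
    have e := congrArg (mdet i j) (hxl.symm.trans hxs')
    simpa only [mdet_comb, mdet_self_left, mdet_self_right, mul_zero, zero_add] using e
  refine ⟨l, hl, ?_⟩
  have h5 : c * (mdet i j k * mdet i j l) < 0 := by
    have : c * (mdet i j k * mdet i j l) = -(t * s * mdet i j k ^ 2) := by
      linear_combination mdet i j k * hm
    rw [this, neg_lt_zero]
    positivity
  by_contra hn
  exact absurd h5 (not_lt.2 (mul_nonneg hc (not_lt.1 hn)))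

variable (T) in
/-- The third vertex of the other triangle at the edge `ij` of the triangle `ijk`. -/
noncomputable def opp (i j k : Mink) : Mink := by
  classical exact if h : T.IsFlag i j k then h.exists_opposite.choose else k

lemma IsFlag.opp (h : T.IsFlag i j k) : T.IsFlag i j (T.opp i j k) := by
  rw [GeodesicTriangulation.opp, dif_pos h]; exact h.exists_opposite.choose_spec.1

lemma IsFlag.mdet_opp (h : T.IsFlag i j k) : mdet i j k * mdet i j (T.opp i j k) < 0 := by
  rw [GeodesicTriangulation.opp, dif_pos h]; exact h.exists_opposite.choose_spec.2

lemma IsFlag.opp_ne (h : T.IsFlag i j k) : k ≠ T.opp i j k := by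
  intro e
  have := h.mdet_opp
  rw [← e] at this
  nlinarith

lemma IsFlag.eq_opp (h : T.IsFlag i j k) (hl : T.IsFlag i j l) (hkl : k ≠ l) :
    l = T.opp i j k := by
  refine hl.eq_of_same_side h.opp ?_
  have h1 : mdet i j k * mdet i j l ≤ 0 := not_lt.1 fun h' => hkl (h.eq_of_same_side hl h')
  have h2 : mdet i j k * mdet i j l < 0 :=
    lt_of_le_of_ne h1 (mul_ne_zero h.mdet_ne_zero hl.mdet_ne_zero)
  have h3 := mul_pos_of_neg_of_neg h2 h.mdet_opp
  have h4 : 0 < mdet i j k ^ 2 * (mdet i j l * mdet i j (T.opp i j k)) := by linarith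
  exact (mul_pos_iff_of_pos_left (sq_pos_of_ne_zero h.mdet_ne_zero)).1 h4

lemma IsFlag.opp_opp (h : T.IsFlag i j k) : T.opp i j (T.opp i j k) = k :=
  (h.opp.eq_opp h h.opp_ne.symm).symm

lemma IsFlag.opp_map {γ : Mink ≃ₗ[ℝ] Mink} (hγ : γ ∈ S.Γ) (h : T.IsFlag i j k) :
    T.opp (γ i) (γ j) (γ k) = γ (T.opp i j k) :=
  ((h.map hγ).eq_opp (h.opp.map hγ) fun e => h.opp_ne (γ.injective e)).symm

lemma IsFlag.adjacent (h : T.IsFlag i j k) : T.Adjacent i j k (T.opp i j k) :=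
  ⟨h, h.opp, h.opp_ne⟩

end GeodesicTriangulation

/-! ### Connectedness of the plane minus the vertices, and of the dual graph. -/

section Chart

/-- The parametrization of the hyperbolic plane by its last two coordinates. -/
noncomputable def hypChart (z : ℝ × ℝ) : Mink := ![Real.sqrt (1 + z.1 ^ 2 + z.2 ^ 2), z.1, z.2]

lemma hypChart_mem (z : ℝ × ℝ) : hypChart z ∈ hyperbolicPlane := by
  have h : 0 < 1 + z.1 ^ 2 + z.2 ^ 2 := by positivity
  refine ⟨?_, Real.sqrt_pos.2 h⟩
  have := Real.mul_self_sqrt h.le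
  simp only [minkInner, hypChart, Matrix.cons_val]
  rw [this]; ring

lemma hypChart_eq {x : Mink} (hx : x ∈ hyperbolicPlane) : hypChart (x 1, x 2) = x := by
  obtain ⟨h, h0⟩ := hx
  refine mink_ext ?_ rfl rfl
  simp only [minkInner] at h
  change Real.sqrt (1 + x 1 ^ 2 + x 2 ^ 2) = x 0
  rw [show 1 + x 1 ^ 2 + x 2 ^ 2 = x 0 ^ 2 by linarith, Real.sqrt_sq h0.le]

lemma continuous_hypChart : Continuous hypChart := by
  refine continuous_pi fun a => ?_
  fin_cases a
  · change Continuous fun z : ℝ × ℝ => Real.sqrt (1 + z.1 ^ 2 + z.2 ^ 2)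
    fun_prop
  · exact continuous_fst
  · exact continuous_snd

lemma injective_hypChart : Function.Injective hypChart := fun _ _ h =>
  Prod.ext (congrFun h 1) (congrFun h 2)

lemma isPreconnected_hyperbolicPlane_diff {V : Set Mink} (hV : V.Countable) :
    IsPreconnected (hyperbolicPlane \ V) := by
  have h1 : (hypChart ⁻¹' V).Countable := hV.preimage injective_hypChart
  have h2 : IsPreconnected (hypChart ⁻¹' V)ᶜ :=
    (h1.isPathConnected_compl_of_one_lt_rank (by norm_num)).isConnected.isPreconnected
  have h3 : hyperbolicPlane \ V = hypChart '' (hypChart ⁻¹' V)ᶜ := by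
    ext x
    constructor
    · rintro ⟨hx, hxV⟩
      exact ⟨(x 1, x 2), by simpa [hypChart_eq hx] using hxV, hypChart_eq hx⟩
    · rintro ⟨z, hz, rfl⟩
      exact ⟨hypChart_mem z, hz⟩
  rw [h3]
  exact h2.image _ continuous_hypChart.continuousOn

end Chart

namespace GeodesicTriangulation

variable {S : ClosedHyperbolicSurface} {T : GeodesicTriangulation S} {i j k l : Mink}

lemma mem_hull_of_mem {f : Finset Mink} (hf : f ∈ T.faces) {v : Mink} (hv : v ∈ f) :
    v ∈ geodesicHull f := by
  refine ⟨T.mem_plane f hf v hv, fun u => if u = v then 1 else 0, ?_, ?_⟩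
  · intro u _
    dsimp only
    split_ifs <;> norm_num
  · simp [hv]

/-- If `v` were not in `f`, the intersection axiom would put it on the geodesic through the other
two vertices of one of its own triangles. -/
lemma mem_of_mem_hull {f : Finset Mink} (hf : f ∈ T.faces) {v : Mink} (hv : v ∈ T.vertices)
    (hvf : v ∈ geodesicHull f) : v ∈ f := by
  obtain ⟨g, hg, hvg⟩ := hv
  have hm : v ∈ geodesicHull (f ∩ g) := by
    rw [← T.inter_eq _ hf _ hg]
    exact ⟨hvf, mem_hull_of_mem hg hvg⟩
  obtain ⟨p, q, rfl, h⟩ := exists_isFlag_of_mem hg hvg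
  by_contra hn
  refine h.rotate.mdet_ne_zero (mdet_eq_zero_of_mem_geodesicHull hm ?_)
  intro u hu
  simp only [Finset.mem_inter, Finset.mem_insert, Finset.mem_singleton] at hu
  rcases hu with ⟨huf, rfl | rfl | rfl⟩
  · exact absurd huf hn
  · exact Or.inl rfl
  · exact Or.inr rfl

lemma IsFlag.smul_add_smul_notMem_vertices (h : T.IsFlag i j k) {a b : ℝ} (ha : 0 < a)
    (hb : 0 < b) (hx : a • i + b • j ∈ hyperbolicPlane) : a • i + b • j ∉ T.vertices := by
  intro hv
  have hm := mem_of_mem_hull h hv (h.mem_hull_iff.2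
    ⟨hx, a, b, 0, ha.le, hb.le, le_rfl, by rw [zero_smul, add_zero]⟩)
  have e : a • i + b • j = a • i + b • j + (0 : ℝ) • k := by rw [zero_smul, add_zero]
  rw [e] at hm
  simp only [Finset.mem_insert, Finset.mem_singleton] at hm
  rcases hm with hm | hm | hm
  · have := comb_unique h.mdet_ne_zero (a' := 1) (b' := 0) (c' := 0) (hm.trans (by simp))
    exact hb.ne' this.2.1
  · have := comb_unique h.mdet_ne_zero (a' := 0) (b' := 1) (c' := 0) (hm.trans (by simp))
    exact ha.ne' this.1
  · have := comb_unique h.mdet_ne_zero (a' := 0) (b' := 0) (c' := 1) (hm.trans (by simp))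
    exact ha.ne' this.1

variable (T) in
lemma countable_vertices : T.vertices.Countable := by
  have h1 : T.faces.Countable := by
    refine (Set.countable_iUnion fun n : ℕ => (T.finite_meeting
      ((isCompact_closedBall (0 : Mink) n).inter_right isClosed_hyperbolicPlane)
      Set.inter_subset_right).countable).mono ?_
    intro f hf
    obtain ⟨i, j, k, rfl, h⟩ := exists_isFlag hf
    obtain ⟨n, hn⟩ := exists_nat_ge ‖i‖
    refine Set.mem_iUnion.2 ⟨n, hf, i, mem_hull_of_mem hf (by simp), ?_, h.mem⟩
    simpa using hn
  refine (h1.biUnion fun f _ => f.countable_toSet).mono ?_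
  rintro v ⟨f, hf, hv⟩
  exact Set.mem_biUnion hf hv

lemma isClosed_biUnion_hull {P : Set (Finset Mink)} (hP : P ⊆ T.faces) :
    IsClosed (⋃ f ∈ P, geodesicHull f) := by
  rw [Set.biUnion_eq_iUnion]
  refine LocallyFinite.isClosed_iUnion ?_ fun f => (isCompact_hull (hP f.2)).isClosed
  intro x
  refine ⟨Metric.closedBall x 1, Metric.closedBall_mem_nhds x one_pos, ?_⟩
  have := T.finite_meeting ((isCompact_closedBall x 1).inter_right isClosed_hyperbolicPlane)
    Set.inter_subset_right
  refine Set.Finite.of_finite_image (f := Subtype.val) (this.subset ?_)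
    Subtype.val_injective.injOn
  rintro _ ⟨f, ⟨y, hyf, hy⟩, rfl⟩
  exact ⟨hP f.2, y, hyf, hy, hyf.1⟩

/-- The dual graph of the triangulation is connected. -/
lemma face_induction {P : Finset Mink → Prop} {f₀ : Finset Mink} (hf₀ : f₀ ∈ T.faces) (h₀ : P f₀)
    (step : ∀ i j k l, T.IsFlag i j k → T.IsFlag i j l → P {i, j, k} → P {i, j, l}) :
    ∀ f ∈ T.faces, P f := by
  by_contra! hne
  obtain ⟨f₁, hf₁, h₁⟩ := hne
  have hU := isClosed_biUnion_hull (T := T) (P := {f ∈ T.faces | P f}) (Set.sep_subset _ _)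
  have hU' := isClosed_biUnion_hull (T := T) (P := {f ∈ T.faces | ¬ P f}) (Set.sep_subset _ _)
  -- The triangles with `P` and those without have closed unions that cover this connected set, so
  -- they meet at a point which is not a vertex.
  have hS := isPreconnected_hyperbolicPlane_diff (countable_vertices T)
  have hpt : ∀ f ∈ T.faces, ∃ x ∈ geodesicHull f, x ∈ hyperbolicPlane \ T.vertices := by
    intro f hf
    obtain ⟨i, j, k, rfl, h⟩ := exists_isFlag hf
    have hx := normalize_mem (minkInner_add_self_neg h.mem h.mem') (add_pos h.mem.2 h.mem'.2)
    have ht : 0 < (Real.sqrt (-minkInner (i + j) (i + j)))⁻¹ :=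
      inv_pos.2 (Real.sqrt_pos.2 (by linarith [minkInner_add_self_neg h.mem h.mem']))
    set t := (Real.sqrt (-minkInner (i + j) (i + j)))⁻¹
    have e : normalize (i + j) = t • i + t • j := by
      rw [← smul_add]; rfl
    rw [e] at hx
    exact ⟨_, h.mem_hull_iff.2 ⟨hx, t, t, 0, ht.le, ht.le, le_rfl, by rw [zero_smul, add_zero]⟩,
      hx, h.smul_add_smul_notMem_vertices ht ht hx⟩
  rw [isPreconnected_closed_iff] at hS
  obtain ⟨x, ⟨hxH, hxV⟩, hx, hx'⟩ := hS _ _ hU hU' (by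
      rintro x ⟨hx, -⟩
      obtain ⟨f, hf, hxf⟩ := T.covers x hx
      by_cases hP : P f
      · exact Or.inl (Set.mem_biUnion (⟨hf, hP⟩ : _ ∧ _) hxf)
      · exact Or.inr (Set.mem_biUnion (⟨hf, hP⟩ : _ ∧ _) hxf))
    (by
      obtain ⟨x, hx, hx'⟩ := hpt f₀ hf₀
      exact ⟨x, hx', Set.mem_biUnion (⟨hf₀, h₀⟩ : _ ∧ _) hx⟩)
    (by
      obtain ⟨x, hx, hx'⟩ := hpt f₁ hf₁
      exact ⟨x, hx', Set.mem_biUnion (⟨hf₁, h₁⟩ : _ ∧ _) hx⟩)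
  simp only [Set.mem_iUnion] at hx hx'
  obtain ⟨f, ⟨hf, hPf⟩, hxf⟩ := hx
  obtain ⟨g, ⟨hg, hPg⟩, hxg⟩ := hx'
  have hm : x ∈ geodesicHull (f ∩ g) := by
    rw [← T.inter_eq _ hf _ hg]; exact ⟨hxf, hxg⟩
  -- With at most one common vertex, the intersection would be empty or that vertex, and vertices
  -- were removed.
  have hcard : 1 < (f ∩ g).card := by
    by_contra hc
    obtain ⟨_, w, hw, hx⟩ := hm
    rcases Finset.card_le_one_iff_subset_singleton.1 (not_lt.1 hc) with ⟨v, hv⟩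
    rcases Finset.subset_singleton_iff.1 hv with h0 | h0
    · rw [h0, Finset.sum_empty] at hx
      have := hxH.2
      rw [hx] at this
      simp at this
    · have hvf : v ∈ f := (Finset.mem_inter.1 (h0 ▸ Finset.mem_singleton_self v)).1
      have hvH := T.mem_plane f hf v hvf
      have hwv := hw v (h0 ▸ Finset.mem_singleton_self v)
      rw [h0, Finset.sum_singleton] at hx
      have h1 := hxH.1
      rw [hx, minkInner_smul_left, minkInner_smul_right, hvH.1] at h1
      have h2 : w v = 1 := by nlinarith
      rw [h2, one_smul] at hx
      exact hxV (hx ▸ ⟨f, hf, hvf⟩)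
  obtain ⟨i, hi, j, hj, hij⟩ := Finset.one_lt_card.1 hcard
  rw [Finset.mem_inter] at hi hj
  obtain ⟨k, rfl, hk⟩ := exists_isFlag_of_mem_mem hf hij hi.1 hj.1
  obtain ⟨l, rfl, hl⟩ := exists_isFlag_of_mem_mem hg hij hi.2 hj.2
  exact hPg (step i j k l hk hl hPf)

end GeodesicTriangulation

/-! ### Linearisation of the length cross-ratio. -/

section Conformal

/-- The logarithmic derivative of `sinh² (λ_{ab} / 2)` along the velocities `ξ`. -/
noncomputable def logScale (ξ : Mink → Mink) (a b : Mink) : ℝ :=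
  (minkInner (ξ a) b + minkInner a (ξ b)) / (1 + minkInner a b)

lemma logScale_comm (ξ : Mink → Mink) (a b : Mink) : logScale ξ a b = logScale ξ b a := by
  rw [logScale, logScale, minkInner_comm a b, minkInner_comm (ξ a), minkInner_comm a (ξ b),
    add_comm (minkInner b (ξ a))]

lemma sinh_half_hypDist_sq {a b : Mink} (ha : a ∈ hyperbolicPlane) (hb : b ∈ hyperbolicPlane) :
    Real.sinh (hypDist a b / 2) ^ 2 = (-1 / 2) * (1 + minkInner a b) := by
  have h := minkInner_le_neg_one ha hb
  have h1 : Real.cosh (hypDist a b) = -minkInner a b := Real.cosh_arcosh (by linarith)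
  have h2 := Real.cosh_two_mul (hypDist a b / 2)
  rw [mul_div_cancel₀ _ two_ne_zero, h1, Real.cosh_sq] at h2
  linarith

/-- Squaring makes the cross-ratio a rational function of inner products, which is easy to
differentiate. -/
lemma lcr_sq {a b c d : Mink} (ha : a ∈ hyperbolicPlane) (hb : b ∈ hyperbolicPlane)
    (hc : c ∈ hyperbolicPlane) (hd : d ∈ hyperbolicPlane) :
    lcr a b c d ^ 2 = ((1 + minkInner a c) * (1 + minkInner b d)) /
      ((1 + minkInner a d) * (1 + minkInner b c)) := by
  rw [lcr, div_pow, mul_pow, mul_pow, sinh_half_hypDist_sq ha hc, sinh_half_hypDist_sq hb hd,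
    sinh_half_hypDist_sq ha hd, sinh_half_hypDist_sq hb hc]
  rw [show (-1 / 2 : ℝ) * (1 + minkInner a c) * (-1 / 2 * (1 + minkInner b d)) =
    (1 / 4) * ((1 + minkInner a c) * (1 + minkInner b d)) by ring,
    show (-1 / 2 : ℝ) * (1 + minkInner a d) * (-1 / 2 * (1 + minkInner b c)) =
    (1 / 4) * ((1 + minkInner a d) * (1 + minkInner b c)) by ring]
  exact mul_div_mul_left _ _ (by norm_num)

/-- A curve in the hyperbolic plane through `v` with velocity `x` there. -/
noncomputable def chartCurve (v x : Mink) (t : ℝ) : Mink := hypChart (v 1 + t * x 1, v 2 + t * x 2)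

lemma contDiff_chartCurve (v x : Mink) : ContDiff ℝ (⊤ : ℕ∞) (chartCurve v x) := by
  rw [contDiff_pi]
  intro a
  fin_cases a
  · change ContDiff ℝ _ fun t => Real.sqrt (1 + (v 1 + t * x 1) ^ 2 + (v 2 + t * x 2) ^ 2)
    refine ContDiff.sqrt (by fun_prop) fun t => ?_
    positivity
  · change ContDiff ℝ _ fun t => v 1 + t * x 1
    fun_prop
  · change ContDiff ℝ _ fun t => v 2 + t * x 2
    fun_prop

lemma chartCurve_zero {v : Mink} (hv : v ∈ hyperbolicPlane) (x : Mink) : chartCurve v x 0 = v := by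
  simp [chartCurve, hypChart_eq hv]

lemma hasDerivAt_chartCurve {v x : Mink} (hv : v ∈ hyperbolicPlane) (hx : minkInner v x = 0) :
    HasDerivAt (chartCurve v x) x 0 := by
  have h1 : HasDerivAt (fun t => v 1 + t * x 1) (x 1) 0 := by
    simpa using ((hasDerivAt_id (0 : ℝ)).mul_const (x 1)).const_add (v 1)
  have h2 : HasDerivAt (fun t => v 2 + t * x 2) (x 2) 0 := by
    simpa using ((hasDerivAt_id (0 : ℝ)).mul_const (x 2)).const_add (v 2)
  rw [hasDerivAt_pi]
  intro a
  fin_cases a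
  · change HasDerivAt (fun t => Real.sqrt (1 + (v 1 + t * x 1) ^ 2 + (v 2 + t * x 2) ^ 2)) (x 0) 0
    have h0 : 1 + (v 1 + 0 * x 1) ^ 2 + (v 2 + 0 * x 2) ^ 2 = v 0 ^ 2 := by
      have := hv.1
      simp only [minkInner] at this
      linear_combination this
    have h3 := (((h1.pow 2).const_add 1).add (h2.pow 2)).sqrt (by
      simp only [Pi.add_apply, Pi.pow_apply]
      rw [h0]; exact (pow_pos hv.2 2).ne')
    refine HasDerivAt.congr_deriv h3 ?_
    change _ / (2 * Real.sqrt (1 + (v 1 + 0 * x 1) ^ 2 + (v 2 + 0 * x 2) ^ 2)) = x 0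
    rw [h0, Real.sqrt_sq hv.2.le]
    have hv0 := hv.2
    simp only [minkInner] at hx
    rw [div_eq_iff (by positivity)]
    norm_num
    linear_combination 2 * hx
  · exact h1
  · exact h2

lemma HasDerivAt.minkInner {f g : ℝ → Mink} {f' g' : Mink} {t : ℝ} (hf : HasDerivAt f f' t)
    (hg : HasDerivAt g g' t) : HasDerivAt (fun s => minkInner (f s) (g s))
      (HypCircle.minkInner f' (g t) + HypCircle.minkInner (f t) g') t := by
  rw [hasDerivAt_pi] at hf hg
  have := ((((hf 0).mul (hg 0)).neg).add ((hf 1).mul (hg 1))).add ((hf 2).mul (hg 2))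
  refine this.congr_deriv ?_
  simp only [HypCircle.minkInner]
  ring

variable {S : ClosedHyperbolicSurface} {T : GeodesicTriangulation S} {ξ : Mink → Mink}
  {i j k l : Mink}

/-- The logarithmic derivative of the squared cross-ratio, computed on one convenient motion of the
vertices. -/
lemma IsInfConformal.logScale_eq (hξ : IsInfDeformation T ξ) (hconf : IsInfConformal T ξ)
    (hk : T.IsFlag i j k) (hl : T.IsFlag i j l) (hkl : k ≠ l) :
    logScale ξ i k + logScale ξ j l = logScale ξ i l + logScale ξ j k := by
  have h := hconf (fun v => chartCurve v (ξ v)) (fun v hv => ⟨contDiff_chartCurve _ _,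
    fun t => hypChart_mem _, chartCurve_zero (T.vertex_mem_plane hv) _,
    hasDerivAt_chartCurve (T.vertex_mem_plane hv) (hξ.tangent v hv)⟩) i j k l ⟨hk, hl, hkl⟩
  have hd : ∀ a ∈ T.vertices, ∀ b ∈ T.vertices,
      HasDerivAt (fun t => 1 + minkInner (chartCurve a (ξ a) t) (chartCurve b (ξ b) t))
        (minkInner (ξ a) b + minkInner a (ξ b)) 0 := by
    intro a ha b hb
    have := (HasDerivAt.minkInner
      (hasDerivAt_chartCurve (T.vertex_mem_plane ha) (hξ.tangent a ha))
      (hasDerivAt_chartCurve (T.vertex_mem_plane hb) (hξ.tangent b hb))).const_add 1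
    rwa [chartCurve_zero (T.vertex_mem_plane ha), chartCurve_zero (T.vertex_mem_plane hb)] at this
  have hz : ∀ a ∈ T.vertices, ∀ b ∈ T.vertices,
      1 + minkInner (chartCurve a (ξ a) 0) (chartCurve b (ξ b) 0) = 1 + minkInner a b := by
    intro a ha b hb
    rw [chartCurve_zero (T.vertex_mem_plane ha), chartCurve_zero (T.vertex_mem_plane hb)]
  have hi := hk.vertex
  have hj := hk.swap.vertex
  have hkv := hk.rotate.rotate.vertex
  have hlv := hl.rotate.rotate.vertex
  have n1 : 1 + minkInner i k ≠ 0 := by linarith [minkInner_lt_neg_one hk.mem hk.mem'' hk.ne']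
  have n2 : 1 + minkInner j l ≠ 0 := by linarith [minkInner_lt_neg_one hl.mem' hl.mem'' hl.ne'']
  have n3 : 1 + minkInner i l ≠ 0 := by linarith [minkInner_lt_neg_one hl.mem hl.mem'' hl.ne']
  have n4 : 1 + minkInner j k ≠ 0 := by linarith [minkInner_lt_neg_one hk.mem' hk.mem'' hk.ne'']
  have h1 := h.pow 2
  have h2 := (((hd i hi k hkv).mul (hd j hj l hlv)).div ((hd i hi l hlv).mul (hd j hj k hkv))
    (by simp only [Pi.mul_apply]; rw [hz i hi l hlv, hz j hj k hkv]; exact mul_ne_zero n3 n4))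
  have h4 := h1.unique (h2.congr_of_eventuallyEq (Eventually.of_forall fun t =>
    lcr_sq (hypChart_mem _) (hypChart_mem _) (hypChart_mem _) (hypChart_mem _)))
  simp only [Pi.mul_apply, hz i hi l hlv, hz j hj k hkv, hz i hi k hkv, hz j hj l hlv] at h4
  simp only [mul_zero] at h4
  rw [eq_comm, div_eq_zero_iff, or_iff_left (pow_ne_zero 2 (mul_ne_zero n3 n4))] at h4
  simp only [logScale]
  field_simp
  linear_combination h4

lemma IsInfDeformation.logScale_map (hξ : IsInfDeformation T ξ) {γ : Mink ≃ₗ[ℝ] Mink}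
    (hγ : γ ∈ S.Γ) {a b : Mink} (ha : a ∈ T.vertices) (hb : b ∈ T.vertices) :
    logScale ξ (γ a) (γ b) = logScale ξ a b := by
  obtain ⟨A, hA, h⟩ := hξ.equivariant γ hγ
  have hi := (S.isometric γ hγ).1
  rw [logScale, h a ha, h b hb, hi, minkInner_add_left, minkInner_add_right, hi, hi, logScale]
  congr 1
  linear_combination hA (γ a) (γ b)

end Conformal

/-! ### The infinitesimal Möbius transformation of a triangle; edge fluxes and weights. -/

section LocalAlgebra

variable (ξ : Mink → Mink) (i j k l : Mink)

/-- The logarithmic scale factor at the vertex `i` of the triangle `ijk`. -/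
noncomputable def scale : ℝ := (logScale ξ i j + logScale ξ i k - logScale ξ j k) / 2

lemma scale_swap : scale ξ i k j = scale ξ i j k := by
  rw [scale, scale, logScale_comm ξ k j]; ring

lemma scale_add : scale ξ i j k + scale ξ j k i = logScale ξ i j := by
  rw [scale, scale, logScale_comm ξ j i, logScale_comm ξ k i]; ring

/-- The translational part of the infinitesimal Möbius transformation which moves the vertices of
the triangle `ijk` with the velocities `ξ`. -/
noncomputable def transVec : Mink :=
  (mdet i j k)⁻¹ • (scale ξ i j k • mcross j k + scale ξ j k i • mcross k i
    + scale ξ k i j • mcross i j)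

/-- The moment of the pair `ij`. -/
noncomputable def edgeMoment : ℝ :=
  minkInner (ξ i) j - scale ξ i j k * minkInner i j - scale ξ j k i

/-- The rotational part of the infinitesimal Möbius transformation which moves the vertices of
the triangle `ijk` with the velocities `ξ`. -/
noncomputable def rotVec : Mink :=
  (mdet i j k)⁻¹ • (edgeMoment ξ i j k • k + edgeMoment ξ j k i • i + edgeMoment ξ k i j • j)

lemma transVec_rotate : transVec ξ j k i = transVec ξ i j k := by
  rw [transVec, transVec, mdet_rotate]
  congr 1
  abel

lemma rotVec_rotate : rotVec ξ j k i = rotVec ξ i j k := by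
  rw [rotVec, rotVec, mdet_rotate]
  congr 1
  abel

/-- The orientation sign of a triple. -/
noncomputable def orient : ℝ := mdet i j k / |mdet i j k|

lemma orient_rotate : orient j k i = orient i j k := by rw [orient, orient, mdet_rotate]

variable {ξ i j k l}

lemma orient_opposite (h : mdet i j k * mdet i j l < 0) : orient i j l = -orient i j k := by
  rw [orient, orient]
  rcases mul_neg_iff.1 h with ⟨h1, h2⟩ | ⟨h1, h2⟩
  · rw [abs_of_pos h1, abs_of_neg h2, div_neg, div_self h1.ne', div_self h2.ne]
  · rw [abs_of_neg h1, abs_of_pos h2, div_neg, div_self h1.ne, div_self h2.ne', neg_neg]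

/-- `transVec` is written in the dual basis to have prescribed products with the vertices. This
value makes u i + a + w×i tangent at `i`. -/
lemma minkInner_transVec (hD : mdet i j k ≠ 0) : minkInner (transVec ξ i j k) i = scale ξ i j k := by
  rw [transVec, minkInner_smul_left, minkInner_add_left, minkInner_add_left, minkInner_smul_left,
    minkInner_smul_left, minkInner_smul_left, minkInner_mcross, minkInner_mcross,
    minkInner_mcross, mdet_self_right, mdet_self_left, mdet_rotate i j k]
  field_simp
  ring

lemma mdet_rotVec (hD : mdet i j k ≠ 0) : mdet i j (rotVec ξ i j k) = edgeMoment ξ i j k := by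
  rw [rotVec, ← minkInner_mcross, minkInner_smul_right, minkInner_mcross, mdet_comb,
    mdet_self_left, mdet_self_right]
  field_simp
  ring

/-- Compatibility of the equations for w: the moment of an edge computed from either end is the same
up to sign, since the two scale factors add up to `logScale`. -/
lemma edgeMoment_add (hp : 1 + minkInner i j ≠ 0) :
    edgeMoment ξ i j k = -(minkInner (ξ j) i - scale ξ j k i * minkInner i j - scale ξ i j k) := by
  have h := scale_add ξ i j k
  rw [logScale, eq_div_iff hp, minkInner_comm i (ξ j)] at h
  rw [edgeMoment]
  linear_combination -h

/-- The infinitesimal Möbius transformation `x ↦ u x + a + w × x` of a triangle. -/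
lemma velocity_eq (hD : mdet i j k ≠ 0) (hi : minkInner i i = -1) (hik : 1 + minkInner k i ≠ 0)
    (ht : minkInner i (ξ i) = 0) :
    ξ i = scale ξ i j k • i + transVec ξ i j k + mcross (rotVec ξ i j k) i := by
  rw [← sub_eq_zero]
  have hDj : mdet j k i ≠ 0 := by rwa [mdet_rotate]
  have hDk : mdet k i j ≠ 0 := by rwa [← mdet_rotate k i j]
  have hai := minkInner_transVec (ξ := ξ) hD
  have haj := minkInner_transVec (ξ := ξ) hDj
  have hak := minkInner_transVec (ξ := ξ) hDk
  rw [transVec_rotate] at haj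
  rw [← transVec_rotate ξ k i j] at hak
  have hwj := mdet_rotVec (ξ := ξ) hD
  have hwk := mdet_rotVec (ξ := ξ) hDk
  rw [← rotVec_rotate ξ k i j, edgeMoment_add hik] at hwk
  refine eq_zero_of_minkInner hD ?_ ?_ ?_
  · rw [minkInner_sub_left, minkInner_add_left, minkInner_add_left, minkInner_smul_left,
      minkInner_mcross, mdet_self_right, hai, hi, minkInner_comm, ht]
    ring
  · rw [minkInner_sub_left, minkInner_add_left, minkInner_add_left, minkInner_smul_left,
      minkInner_mcross, haj, ← mdet_rotate, hwj, edgeMoment]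
    ring
  · rw [minkInner_sub_left, minkInner_add_left, minkInner_add_left, minkInner_smul_left,
      minkInner_mcross, hak, ← mdet_rotate, mdet_swap', hwk, minkInner_comm i k]
    ring

/-- The jump of the infinitesimal Möbius transformation across an edge. -/
lemma jump_relations {b w : Mink} (hi : minkInner i i = -1) (hj : minkInner j j = -1)
    (hp : 1 + minkInner i j ≠ 0) (h1 : b + mcross w i = 0) (h2 : b + mcross w j = 0) :
    minkInner w j = -minkInner w i ∧
      minkInner b (mcross i j) = (minkInner i j - 1) * minkInner w i := by
  have e1 : minkInner (b + mcross w i) (mcross i j) = 0 := by rw [h1]; simp [minkInner]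
  have e2 : minkInner (b + mcross w j) (mcross i j) = 0 := by rw [h2]; simp [minkInner]
  rw [minkInner_add_left, minkInner_mcross_mcross] at e1 e2
  rw [hi] at e1
  rw [hj, minkInner_comm j i] at e2
  have e3 : minkInner w j = -minkInner w i := by
    have : (1 + minkInner i j) * (minkInner w j + minkInner w i) = 0 := by
      linear_combination e2 - e1
    have := (mul_eq_zero.1 this).resolve_left hp
    linarith
  exact ⟨e3, by rw [e3] at e1; linear_combination e1⟩

variable (ξ i j k) in
/-- The contribution of the edge `ij` of the triangle `ijk` to the first variation of the angle
sums. -/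
noncomputable def edgeFlux : ℝ :=
  (scale ξ i j k + scale ξ j k i) *
    (-scale ξ i j k * (minkInner i j * minkInner j k + minkInner k i)
      - scale ξ j k i * (minkInner i j * minkInner k i + minkInner j k)
      + scale ξ k i j * (minkInner i j ^ 2 - 1)) / (|mdet i j k| * (minkInner i j - 1))

variable (i j k) in
/-- The contribution of the triangle `ijk` to the weight of its edge `ij`. -/
noncomputable def edgeWeight : ℝ :=
  (minkInner i j - minkInner j k - minkInner k i - 1) / (2 * |mdet i j k|)

variable (ξ i j k) in
/-- The energy density of an edge. -/
noncomputable def edgeEnergy : ℝ :=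
  (scale ξ i j k - scale ξ j k i) ^ 2 +
    (1 + minkInner i j) / (minkInner i j - 1) * (scale ξ i j k + scale ξ j k i) ^ 2

/-- This is the form in which the flux meets `jump_relations`: the component of the translational
part along `mcross i j` has a jump proportional to that of the rotation speed. -/
lemma edgeFlux_eq (hi : minkInner i i = -1) (hj : minkInner j j = -1) (hD : mdet i j k ≠ 0) :
    edgeFlux ξ i j k = orient i j k * (scale ξ i j k + scale ξ j k i) *
      (minkInner (transVec ξ i j k) (mcross i j) / (minkInner i j - 1)) := by
  have h : minkInner (transVec ξ i j k) (mcross i j) = (mdet i j k)⁻¹ *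
      (-scale ξ i j k * (minkInner i j * minkInner j k + minkInner k i)
      - scale ξ j k i * (minkInner i j * minkInner k i + minkInner j k)
      + scale ξ k i j * (minkInner i j ^ 2 - 1)) := by
    rw [transVec, minkInner_smul_left, minkInner_add_left, minkInner_add_left,
      minkInner_smul_left, minkInner_smul_left, minkInner_smul_left, minkInner_mcross_mcross,
      minkInner_mcross_mcross, minkInner_mcross_mcross, hi, hj, minkInner_comm j i,
      minkInner_comm k j]
    ring
  rw [h, edgeFlux, orient]
  have h0 : |mdet i j k| ≠ 0 := abs_ne_zero.2 hD
  generalize |mdet i j k| = d at *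
  generalize mdet i j k = D at *
  by_cases hp : minkInner i j - 1 = 0
  · rw [hp]; simp
  · field_simp

/-- An identity of quadratic forms in the three scale factors. It holds only for the whole triangle,
not edge by edge. -/
lemma edgeFlux_sum (hp : minkInner i j - 1 ≠ 0) (hq : minkInner j k - 1 ≠ 0)
    (hr : minkInner k i - 1 ≠ 0) :
    edgeFlux ξ i j k + edgeFlux ξ j k i + edgeFlux ξ k i j =
      edgeWeight i j k * edgeEnergy ξ i j k + edgeWeight j k i * edgeEnergy ξ j k i +
        edgeWeight k i j * edgeEnergy ξ k i j := by
  simp only [edgeFlux, edgeWeight, edgeEnergy]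
  rw [mdet_rotate i j k, ← mdet_rotate k i j]
  by_cases h0 : |mdet i j k| = 0
  · simp [h0]
  generalize |mdet i j k| = d at *
  generalize minkInner i j = p at *
  generalize minkInner j k = q at *
  generalize minkInner k i = r at *
  generalize scale ξ i j k = u at *
  generalize scale ξ j k i = v at *
  generalize scale ξ k i j = w at *
  field_simp
  ring

variable (i j k) in
/-- The vector `o` such that the circumcycle of `ijk` lies in the plane `⟨x, o⟩ = -1`. -/
noncomputable def circumVec : Mink :=
  -((mdet i j k)⁻¹ • (mcross j k + mcross k i + mcross i j))

lemma circumVec_rotate : circumVec j k i = circumVec i j k := by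
  rw [circumVec, circumVec, mdet_rotate]
  congr 2
  abel

lemma circumVec_swap : circumVec i k j = circumVec i j k := by
  rw [circumVec, circumVec, mdet_swap]
  have : ∀ x y : Mink, mcross x y = -mcross y x := by
    intro x y
    apply mink_ext <;>
      simp only [mcross_zero, mcross_one, mcross_two, Pi.neg_apply] <;> ring
  rw [this k j, this j i, this i k, inv_neg]
  module

lemma minkInner_circumVec (hD : mdet i j k ≠ 0) : minkInner i (circumVec i j k) = -1 := by
  rw [circumVec, minkInner_neg_right, minkInner_smul_right, minkInner_add_right,
    minkInner_add_right, minkInner_mcross', minkInner_mcross', minkInner_mcross', mdet_self_right,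
    mdet_self_left, mdet_rotate i j k]
  field_simp
  ring

lemma edgeWeight_eq (hi : minkInner i i = -1) (hj : minkInner j j = -1) (hD : mdet i j k ≠ 0)
    (hp : 1 + minkInner i j ≠ 0) : edgeWeight i j k =
      -orient i j k * minkInner (circumVec i j k) (mcross i j) / (2 * (1 + minkInner i j)) := by
  have h : minkInner (circumVec i j k) (mcross i j) = (mdet i j k)⁻¹ *
      ((1 + minkInner i j) * (minkInner j k + minkInner k i - minkInner i j + 1)) := by
    rw [circumVec, minkInner_comm, minkInner_neg_right, minkInner_smul_right, minkInner_add_right,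
      minkInner_add_right, minkInner_mcross_mcross,
      minkInner_mcross_mcross, minkInner_mcross_mcross, hi, hj, minkInner_comm j i,
      minkInner_comm i k]
    ring
  rw [h, edgeWeight, orient]
  have h0 : |mdet i j k| ≠ 0 := abs_ne_zero.2 hD
  generalize |mdet i j k| = d at *
  generalize mdet i j k = D at *
  field_simp
  ring

/-- The weight of an edge in terms of the defect of the Delaunay condition. -/
lemma edgeWeight_add (hi : minkInner i i = -1) (hj : minkInner j j = -1)
    (hp : 1 + minkInner i j ≠ 0) (hk : mdet i j k ≠ 0) (hl : mdet i j l ≠ 0)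
    (hkl : mdet i j k * mdet i j l < 0) : edgeWeight i j k + edgeWeight i j l =
      (minkInner i j - 1) / (2 * |mdet i j l|) * (1 + minkInner l (circumVec i j k)) := by
  have hk1 := minkInner_circumVec hk
  have hk2 := minkInner_circumVec (i := j) (j := k) (k := i) (by rwa [mdet_rotate])
  have hl1 := minkInner_circumVec hl
  have hl2 := minkInner_circumVec (i := j) (j := l) (k := i) (by rwa [mdet_rotate])
  have hl3 := minkInner_circumVec (i := l) (j := i) (k := j) (by rwa [← mdet_rotate])
  rw [circumVec_rotate] at hk2 hl2
  rw [← circumVec_rotate] at hl3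
  rw [edgeWeight_eq hi hj hk hp, edgeWeight_eq hi hj hl hp, orient_opposite hkl]
  -- The difference of the two circumvectors is orthogonal to `i` and `j`, so it is a multiple of
  -- `mcross i j`; pairing with `l` gives the factor.
  have hb := mdet_smul_eq_dual i j l (circumVec i j k - circumVec i j l)
  rw [minkInner_comm _ i, minkInner_comm _ j, minkInner_comm _ l, minkInner_sub_right,
    minkInner_sub_right, minkInner_sub_right, hk1, hk2, hl1, hl2, hl3] at hb
  have hb' := congrArg (fun x => minkInner x (mcross i j)) hb
  simp only [sub_self, zero_smul, zero_add, minkInner_smul_left, minkInner_sub_left,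
    minkInner_mcross_mcross, hi, hj, minkInner_comm j i] at hb'
  have ho : orient i j k = -orient i j l := by rw [orient_opposite hkl, neg_neg]
  rw [ho, orient]
  have h0 : |mdet i j l| ≠ 0 := abs_ne_zero.2 hl
  generalize |mdet i j l| = d at *
  generalize mdet i j l = D at *
  field_simp
  linear_combination hb'

/-- If an edge carries no weight, the two triangles adjacent to it have the same circumcycle. -/
lemma circumVec_eq (hk : mdet i j k ≠ 0) (hl : mdet i j l ≠ 0)
    (h : minkInner l (circumVec i j k) = -1) : circumVec i j k = circumVec i j l := by
  have hk1 := minkInner_circumVec hk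
  have hk2 := minkInner_circumVec (i := j) (j := k) (k := i) (by rwa [mdet_rotate])
  have hl1 := minkInner_circumVec hl
  have hl2 := minkInner_circumVec (i := j) (j := l) (k := i) (by rwa [mdet_rotate])
  have hl3 := minkInner_circumVec (i := l) (j := i) (k := j) (by rwa [← mdet_rotate])
  rw [circumVec_rotate] at hk2 hl2
  rw [← circumVec_rotate] at hl3
  refine sub_eq_zero.1 (eq_zero_of_minkInner hl ?_ ?_ ?_)
  · rw [minkInner_comm, minkInner_sub_right, hk1, hl1, sub_self]
  · rw [minkInner_comm, minkInner_sub_right, hk2, hl2, sub_self]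
  · rw [minkInner_comm, minkInner_sub_right, h, hl3, sub_self]

end LocalAlgebra

/-! ### Sums over orbits. -/

section OrbitSum

/-- The sum over the orbits of an invariant function. -/
noncomputable def orbitSum {X : Type*} (r : Setoid X) [Finite (Quotient r)] (f : X → ℝ) : ℝ :=
  ∑ᶠ c : Quotient r, f c.out

variable {X : Type*} (r : Setoid X) [Finite (Quotient r)]

lemma orbitSum_add (f g : X → ℝ) : orbitSum r (fun x => f x + g x) = orbitSum r f + orbitSum r g :=
  finsum_add_distrib (Set.toFinite _) (Set.toFinite _)

lemma orbitSum_sub (f g : X → ℝ) : orbitSum r (fun x => f x - g x) = orbitSum r f - orbitSum r g :=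
  finsum_sub_distrib (Set.toFinite _) (Set.toFinite _)

/-- An equivariant permutation descends to the quotient and reindexes the sum there; this plays the
role of summation by parts on the surface. -/
lemma orbitSum_comp {f : X → ℝ} (hf : ∀ x y, r x y → f x = f y) (σ : Equiv.Perm X)
    (hσ : ∀ x y, r x y ↔ r (σ x) (σ y)) : orbitSum r (fun x => f (σ x)) = orbitSum r f := by
  have h : ∀ c : Quotient r, f (σ c.out) = f (Quotient.congr σ hσ c).out := by
    intro c
    apply hf
    induction c using Quotient.inductionOn with
    | h x =>
      have h1 : r (⟦x⟧ : Quotient r).out x := Quotient.mk_out x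
      have h2 : r (⟦σ x⟧ : Quotient r).out (σ x) := Quotient.mk_out (σ x)
      exact r.trans ((hσ _ _).1 h1) (r.symm h2)
  simp only [orbitSum, h]
  exact finsum_comp_equiv (Quotient.congr σ hσ) (f := fun c => f c.out)

lemma eq_zero_of_orbitSum {f : X → ℝ} (hf : ∀ x y, r x y → f x = f y) (h0 : ∀ x, 0 ≤ f x)
    (hs : orbitSum r f = 0) (x : X) : f x = 0 := by
  have := Fintype.ofFinite (Quotient r)
  rw [orbitSum, finsum_eq_sum_of_fintype, Finset.sum_eq_zero_iff_of_nonneg fun c _ => h0 _] at hs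
  rw [← hs ⟦x⟧ (Finset.mem_univ _)]
  exact hf _ _ (r.symm (Quotient.mk_out x))

end OrbitSum

/-! ### Flags of the closed surface and their permutations. -/

namespace GeodesicTriangulation

variable {S : ClosedHyperbolicSurface} (T : GeodesicTriangulation S)

/-- The triangles with ordered vertices. -/
abbrev Flag : Type := {x : Mink × Mink × Mink // T.IsFlag x.1 x.2.1 x.2.2}

/-- Flags are equivalent if they project to the same flag of the surface. -/
def flagSetoid : Setoid T.Flag where
  r x y := ∃ γ ∈ S.Γ, y.1 = (γ x.1.1, γ x.1.2.1, γ x.1.2.2)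
  iseqv := by
    refine ⟨fun x => ⟨1, S.Γ.one_mem, rfl⟩, ?_, ?_⟩
    · rintro x y ⟨γ, hγ, h⟩
      refine ⟨γ⁻¹, S.Γ.inv_mem hγ, ?_⟩
      have h1 : ∀ v, (γ⁻¹ : Mink ≃ₗ[ℝ] Mink) (γ v) = v := γ.symm_apply_apply
      rw [h, h1, h1, h1]
    · rintro x y z ⟨γ, hγ, h⟩ ⟨δ, hδ, h'⟩
      refine ⟨δ * γ, S.Γ.mul_mem hδ hγ, ?_⟩
      rw [h', h]; rfl

instance : Finite (Quotient T.flagSetoid) := by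
  classical
  obtain ⟨F₀, hF₀⟩ := T.finite_mod
  set B : Finset Mink := F₀.biUnion id with hB
  have hfin : {x : T.Flag | x.1 ∈ (B ×ˢ B ×ˢ B)}.Finite :=
    Set.Finite.preimage Subtype.val_injective.injOn (B ×ˢ B ×ˢ B).finite_toSet
  have := hfin.to_subtype
  refine Finite.of_surjective
    (fun x : {x : T.Flag | x.1 ∈ (B ×ˢ B ×ˢ B)} => (⟦x.1⟧ : Quotient T.flagSetoid)) ?_
  intro c
  induction c using Quotient.inductionOn with
  | h x =>
    obtain ⟨⟨i, j, k⟩, hx⟩ := x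
    obtain ⟨γ, hγ, f₀, hf₀, he⟩ := hF₀ _ hx
    have hmem : ∀ v ∈ ({i, j, k} : Finset Mink), (γ⁻¹ : Mink ≃ₗ[ℝ] Mink) v ∈ B := by
      intro v hv
      rw [he] at hv
      obtain ⟨u, hu, rfl⟩ := Finset.mem_image.1 hv
      have h1 : (γ⁻¹ : Mink ≃ₗ[ℝ] Mink) (γ u) = u := γ.symm_apply_apply u
      rw [h1]
      exact Finset.mem_biUnion.2 ⟨f₀, hf₀, hu⟩
    have hγ' : γ⁻¹ ∈ S.Γ := S.Γ.inv_mem hγ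
    refine ⟨⟨⟨((γ⁻¹ : Mink ≃ₗ[ℝ] Mink) i, (γ⁻¹ : Mink ≃ₗ[ℝ] Mink) j, (γ⁻¹ : Mink ≃ₗ[ℝ] Mink) k),
      IsFlag.map hγ' hx⟩, ?_⟩, ?_⟩
    · simp only [Set.mem_ofPred_eq, Finset.mem_product]
      exact ⟨hmem i (by simp), hmem j (by simp), hmem k (by simp)⟩
    · refine Quotient.sound ⟨γ, hγ, ?_⟩
      have h1 : ∀ v, γ ((γ⁻¹ : Mink ≃ₗ[ℝ] Mink) v) = v := γ.apply_symm_apply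
      simp only [h1]

/-- The cyclic rotation of the vertices of a flag. -/
def rotatePerm : Equiv.Perm T.Flag where
  toFun x := ⟨(x.1.2.1, x.1.2.2, x.1.1), x.2.rotate⟩
  invFun x := ⟨(x.1.2.2, x.1.1, x.1.2.1), x.2.rotate.rotate⟩
  left_inv _ := rfl
  right_inv _ := rfl

/-- The passage from a triangle to the adjacent one. -/
noncomputable def oppPerm : Equiv.Perm T.Flag :=
  Function.Involutive.toPerm
    (fun x => ⟨(x.1.1, x.1.2.1, T.opp x.1.1 x.1.2.1 x.1.2.2), x.2.opp⟩) fun x => by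
      refine Subtype.ext (Prod.ext rfl (Prod.ext rfl ?_))
      exact x.2.opp_opp

variable {T}

lemma rotatePerm_equivariant (x y : T.Flag) :
    T.flagSetoid x y ↔ T.flagSetoid (T.rotatePerm x) (T.rotatePerm y) := by
  constructor
  · rintro ⟨γ, hγ, h⟩
    refine ⟨γ, hγ, ?_⟩
    simp only [rotatePerm, Equiv.coe_fn_mk, h]
  · rintro ⟨γ, hγ, h⟩
    refine ⟨γ, hγ, ?_⟩
    simp only [rotatePerm, Equiv.coe_fn_mk, Prod.mk.injEq] at h
    exact Prod.ext h.2.2 (Prod.ext h.1 h.2.1)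

lemma oppPerm_equivariant (x y : T.Flag) :
    T.flagSetoid x y ↔ T.flagSetoid (T.oppPerm x) (T.oppPerm y) := by
  have key : ∀ x y : T.Flag, T.flagSetoid x y → T.flagSetoid (T.oppPerm x) (T.oppPerm y) := by
    rintro x ⟨⟨a, b, c⟩, hy⟩ ⟨γ, hγ, h⟩
    simp only [Prod.mk.injEq] at h
    obtain ⟨rfl, rfl, rfl⟩ := h
    exact ⟨γ, hγ, Prod.ext rfl (Prod.ext rfl (x.2.opp_map hγ))⟩
  refine ⟨key x y, fun h => ?_⟩
  have h2 : ∀ x : T.Flag, T.oppPerm (T.oppPerm x) = x :=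
    fun x => Subtype.ext (Prod.ext rfl (Prod.ext rfl x.2.opp_opp))
  simpa only [h2] using key _ _ h

end GeodesicTriangulation

/-! ### An equivariant reference flag at each vertex. -/

section Reference

variable {S : ClosedHyperbolicSurface} (T : GeodesicTriangulation S)

/-- A representative of the orbit of a point. -/
noncomputable def orbitRep (S : ClosedHyperbolicSurface) (v : Mink) : Mink :=
  Classical.epsilon fun x => ∃ γ ∈ S.Γ, x = γ v

lemma orbitRep_spec (S : ClosedHyperbolicSurface) (v : Mink) : ∃ γ ∈ S.Γ, orbitRep S v = γ v :=
  Classical.epsilon_spec (p := fun x => ∃ γ ∈ S.Γ, x = γ v) ⟨v, 1, S.Γ.one_mem, rfl⟩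

lemma orbitRep_map {γ : Mink ≃ₗ[ℝ] Mink} (hγ : γ ∈ S.Γ) (v : Mink) :
    orbitRep S (γ v) = orbitRep S v := by
  unfold orbitRep
  congr 1
  ext x
  constructor
  · rintro ⟨δ, hδ, rfl⟩
    exact ⟨δ * γ, S.Γ.mul_mem hδ hγ, rfl⟩
  · rintro ⟨δ, hδ, rfl⟩
    refine ⟨δ * γ⁻¹, S.Γ.mul_mem hδ (S.Γ.inv_mem hγ), ?_⟩
    exact congrArg δ (γ.symm_apply_apply v).symm

lemma ClosedHyperbolicSurface.eq_of_apply_eq {γ δ : Mink ≃ₗ[ℝ] Mink} (hγ : γ ∈ S.Γ) (hδ : δ ∈ S.Γ)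
    {v : Mink} (hv : v ∈ hyperbolicPlane) (h : γ v = δ v) : γ = δ := by
  have h1 := S.free (δ⁻¹ * γ) (S.Γ.mul_mem (S.Γ.inv_mem hδ) hγ) v hv (by
    change (δ⁻¹ : Mink ≃ₗ[ℝ] Mink) (γ v) = v
    rw [h]; exact δ.symm_apply_apply v)
  exact (inv_mul_eq_one.1 h1).symm

/-- There is an equivariant choice of a flag at each vertex. -/
lemma exists_equivariant_flag : ∃ p q : Mink → Mink, (∀ v ∈ T.vertices, T.IsFlag v (p v) (q v)) ∧
    ∀ γ ∈ S.Γ, ∀ v ∈ T.vertices, p (γ v) = γ (p v) ∧ q (γ v) = γ (q v) := by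
  have h1 : ∀ v, ∃ γ ∈ S.Γ, v = γ (orbitRep S v) := by
    intro v
    obtain ⟨γ, hγ, h⟩ := orbitRep_spec S v
    exact ⟨γ⁻¹, S.Γ.inv_mem hγ, by rw [h]; exact (γ.symm_apply_apply v).symm⟩
  have h2 : ∀ v, ∃ j k, v ∈ T.vertices → T.IsFlag v j k := by
    intro v
    by_cases hv : v ∈ T.vertices
    · obtain ⟨j, k, h⟩ := T.exists_isFlag_of_vertex hv
      exact ⟨j, k, fun _ => h⟩
    · exact ⟨0, 0, fun h => absurd h hv⟩
  have h3 : ∀ v ∈ T.vertices, orbitRep S v ∈ T.vertices := by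
    intro v hv
    obtain ⟨γ, hγ, h⟩ := orbitRep_spec S v
    rw [h]; exact T.vertex_map hγ hv
  choose g hg hgv using h1
  choose p q hpq using h2
  refine ⟨fun v => g v (p (orbitRep S v)), fun v => g v (q (orbitRep S v)), ?_, ?_⟩
  · intro v hv
    have := (hpq _ (h3 v hv)).map (hg v)
    rwa [← hgv v] at this
  · intro γ hγ v hv
    -- Since the action is free, the element that carries the representative to a vertex is unique,
    -- hence equivariant.
    have h4 : g (γ v) = γ * g v := by
      refine S.eq_of_apply_eq (hg _) (S.Γ.mul_mem hγ (hg v)) (T.vertex_mem_plane (h3 v hv)) ?_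
      have := hgv (γ v)
      rw [orbitRep_map hγ] at this
      rw [← this, LinearEquiv.mul_apply, ← hgv v]
    simp only [orbitRep_map hγ, h4, LinearEquiv.mul_apply, and_self]

end Reference

/-! ### Behaviour of the local quantities under the group. -/

section Invariance

variable {S : ClosedHyperbolicSurface} {T : GeodesicTriangulation S} {ξ : Mink → Mink}
  {i j k l : Mink}

open GeodesicTriangulation

lemma IsInfDeformation.scale_map (hξ : IsInfDeformation T ξ) {γ : Mink ≃ₗ[ℝ] Mink}
    (hγ : γ ∈ S.Γ) (h : T.IsFlag i j k) : scale ξ (γ i) (γ j) (γ k) = scale ξ i j k := by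
  rw [scale, scale, hξ.logScale_map hγ h.vertex h.rotate.vertex,
    hξ.logScale_map hγ h.vertex h.rotate.rotate.vertex,
    hξ.logScale_map hγ h.rotate.vertex h.rotate.rotate.vertex]

lemma abs_mdet_map {γ : Mink ≃ₗ[ℝ] Mink} (hγ : γ ∈ S.Γ) (i j k : Mink) :
    |mdet (γ i) (γ j) (γ k)| = |mdet i j k| := by
  obtain ⟨δ, hδ, h⟩ := (S.isometric γ hγ).exists_mdet
  have h1 : |δ| = 1 := by
    rw [← Real.sqrt_sq_eq_abs, hδ, Real.sqrt_one]
  rw [h, abs_mul, h1, one_mul]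

lemma edgeWeight_map {γ : Mink ≃ₗ[ℝ] Mink} (hγ : γ ∈ S.Γ) (i j k : Mink) :
    edgeWeight (γ i) (γ j) (γ k) = edgeWeight i j k := by
  simp only [edgeWeight, abs_mdet_map hγ, (S.isometric γ hγ).1]

lemma IsInfDeformation.edgeFlux_map (hξ : IsInfDeformation T ξ) {γ : Mink ≃ₗ[ℝ] Mink}
    (hγ : γ ∈ S.Γ) (h : T.IsFlag i j k) : edgeFlux ξ (γ i) (γ j) (γ k) = edgeFlux ξ i j k := by
  simp only [edgeFlux, abs_mdet_map hγ, (S.isometric γ hγ).1, hξ.scale_map hγ h,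
    hξ.scale_map hγ h.rotate, hξ.scale_map hγ h.rotate.rotate]

lemma IsInfDeformation.edgeEnergy_map (hξ : IsInfDeformation T ξ) {γ : Mink ≃ₗ[ℝ] Mink}
    (hγ : γ ∈ S.Γ) (h : T.IsFlag i j k) : edgeEnergy ξ (γ i) (γ j) (γ k) = edgeEnergy ξ i j k := by
  simp only [edgeEnergy, (S.isometric γ hγ).1, hξ.scale_map hγ h, hξ.scale_map hγ h.rotate]

/-- The rotational part transforms under the holonomy like an axial vector, up to a vector that
depends only on the group element. -/
lemma IsInfDeformation.rotVec_map (hξ : IsInfDeformation T ξ) {γ : Mink ≃ₗ[ℝ] Mink}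
    (hγ : γ ∈ S.Γ) : ∃ (δ : ℝ) (w : Mink), δ ^ 2 = 1 ∧ ∀ i j k, T.IsFlag i j k →
      orient (γ i) (γ j) (γ k) = δ * orient i j k ∧
      minkInner (rotVec ξ (γ i) (γ j) (γ k)) (γ i) =
        δ * minkInner (rotVec ξ i j k) i + minkInner w (γ i) := by
  obtain ⟨A, hA, hAγ⟩ := hξ.equivariant γ hγ
  obtain ⟨w, hw⟩ := hA.exists_mcross
  obtain ⟨δ, hδ, h⟩ := (S.isometric γ hγ).exists_mdet
  have hi := (S.isometric γ hγ).1
  refine ⟨δ, w, hδ, fun i j k hf => ⟨?_, ?_⟩⟩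
  · rw [orient, orient, abs_mdet_map hγ, h, mul_div_assoc]
  -- The holonomy adds the moments of the fixed vector `w`; by Cramer's rule they reassemble to `w`
  -- in the rotational part.
  have hm : ∀ a b c, T.IsFlag a b c → edgeMoment ξ (γ a) (γ b) (γ c) =
      edgeMoment ξ a b c + mdet w (γ a) (γ b) := by
    intro a b c hf
    rw [edgeMoment, edgeMoment, hξ.scale_map hγ hf, hξ.scale_map hγ hf.rotate, hAγ a hf.vertex,
      minkInner_add_left, hi, hi, hw, minkInner_mcross]
    ring
  have hD := hf.mdet_ne_zero
  have hw' := congrArg (fun x => minkInner x (γ i)) (mdet_smul_eq (γ i) (γ j) (γ k) w)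
  simp only [minkInner_add_left, minkInner_smul_left, hi] at hw'
  rw [← mdet_rotate (γ i) w (γ k), mdet_rotate w (γ i) (γ j), h] at hw'
  rw [rotVec, rotVec, hm i j k hf, hm j k i hf.rotate, hm k i j hf.rotate.rotate, h]
  simp only [minkInner_add_left, minkInner_smul_left, hi]
  rcases mul_self_eq_one_iff.1 ((sq δ).symm.trans hδ) with rfl | rfl
  · field_simp
    linear_combination -hw'
  · rw [show (-1 * mdet i j k)⁻¹ = -(mdet i j k)⁻¹ by rw [neg_one_mul, inv_neg]]
    field_simp
    linear_combination hw'

end Invariance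

open GeodesicTriangulation

/-! ### Neighbours of a vertex on a common circumcycle. -/

section Slope

/-- When `i`, `a`, `b` lie on the cycle of `o`, this compares the slopes of `a` and `b` seen from
`i` with the orientation of the triple. -/
lemma mdet_mul_gram (i a b o : Mink) :
    mdet i a b * (minkInner i i * minkInner o o - minkInner i o ^ 2) =
      minkInner i i * (minkInner a o * mdet i o b - mdet i o a * minkInner b o)
      - minkInner i o * (minkInner a i * mdet i o b - mdet i o a * minkInner b i) := by
  simp only [mdet, minkInner, mcross_zero, mcross_one, mcross_two]; ring

/-- The orthogonal complement of a timelike vector is positive definite. -/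
lemma eq_zero_of_null {i v : Mink} (hi : i ∈ hyperbolicPlane) (h : minkInner v i = 0)
    (hv : minkInner v v = 0) : v = 0 := by
  have hii := hi.1
  simp only [minkInner] at h hv hii
  have h1 : (v 1 * i 2 - v 2 * i 1) ^ 2 + v 0 ^ 2 = 0 := by
    have e : v 0 * i 0 = v 1 * i 1 + v 2 * i 2 := by linarith
    have e2 : (v 0 * i 0) ^ 2 = (v 1 * i 1 + v 2 * i 2) ^ 2 := by rw [e]
    linear_combination e2 + (v 0 ^ 2) * hii - (i 1 ^ 2 + i 2 ^ 2) * hv * (-1)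
  have h0 : v 0 = 0 := by
    have : v 0 ^ 2 = 0 := by nlinarith [sq_nonneg (v 1 * i 2 - v 2 * i 1), sq_nonneg (v 0)]
    exact (pow_eq_zero_iff two_ne_zero).1 this
  rw [h0] at hv
  refine mink_ext h0 ?_ ?_
  · have : v 1 ^ 2 = 0 := by nlinarith [sq_nonneg (v 1), sq_nonneg (v 2)]
    exact (pow_eq_zero_iff two_ne_zero).1 this
  · have : v 2 ^ 2 = 0 := by nlinarith [sq_nonneg (v 1), sq_nonneg (v 2)]
    exact (pow_eq_zero_iff two_ne_zero).1 this

end Slope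

variable {S : ClosedHyperbolicSurface} {T : GeodesicTriangulation S} {ξ : Mink → Mink}
  {i j k l : Mink}

/-! ### Comparison of the two triangles at an edge. -/

section Basic

lemma GeodesicTriangulation.IsFlag.self (h : T.IsFlag i j k) : minkInner i i = -1 := h.mem.1

lemma GeodesicTriangulation.IsFlag.lt (h : T.IsFlag i j k) : minkInner i j < -1 :=
  minkInner_lt_neg_one h.mem h.mem' h.ne

lemma GeodesicTriangulation.IsFlag.one_add_ne (h : T.IsFlag i j k) : 1 + minkInner i j ≠ 0 := by
  linarith [h.lt]

lemma scale_opp (hξ : IsInfDeformation T ξ) (hconf : IsInfConformal T ξ) (h : T.IsFlag i j k) :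
    scale ξ i j (T.opp i j k) = scale ξ i j k ∧ scale ξ j (T.opp i j k) i = scale ξ j k i := by
  have e := hconf.logScale_eq hξ h h.opp h.opp_ne
  constructor
  · rw [scale, scale]; linear_combination (-1 / 2) * e
  · rw [scale, scale, logScale_comm ξ (T.opp i j k) i, logScale_comm ξ k i]; linear_combination (1 / 2) * e

lemma velocity_eq_first (hξ : IsInfDeformation T ξ) (h : T.IsFlag i j k) :
    ξ i = scale ξ i j k • i + transVec ξ i j k + mcross (rotVec ξ i j k) i :=
  velocity_eq h.mdet_ne_zero h.self h.rotate.rotate.one_add_ne (hξ.tangent i h.vertex)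

lemma velocity_eq_second (hξ : IsInfDeformation T ξ) (h : T.IsFlag i j k) :
    ξ j = scale ξ j k i • j + transVec ξ i j k + mcross (rotVec ξ i j k) j := by
  have := velocity_eq_first hξ h.rotate
  rwa [transVec_rotate, rotVec_rotate] at this

lemma mcross_sub_left (x y z : Mink) : mcross (x - y) z = mcross x z - mcross y z := by
  apply mink_ext <;> simp only [mcross_zero, mcross_one, mcross_two, Pi.sub_apply] <;> ring

/-- Both triangles have the same scale factors on the edge and opposite orientations, so only the
jump of the translational part survives, and `jump_relations` turns it into the jump of the rotation
speeds. -/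
lemma edgeFlux_add_opp (hξ : IsInfDeformation T ξ) (hconf : IsInfConformal T ξ)
    (h : T.IsFlag i j k) : edgeFlux ξ i j k + edgeFlux ξ i j (T.opp i j k) =
      orient i j k * (scale ξ i j k *
          (minkInner (rotVec ξ i j k) i - minkInner (rotVec ξ i j (T.opp i j k)) i)
        - scale ξ j k i *
          (minkInner (rotVec ξ i j k) j - minkInner (rotVec ξ i j (T.opp i j k)) j)) := by
  obtain ⟨e1, e2⟩ := scale_opp hξ hconf h
  have v1 := velocity_eq_first hξ h
  have v2 := velocity_eq_second hξ h
  have v3 := velocity_eq_first hξ h.opp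
  have v4 := velocity_eq_second hξ h.opp
  rw [e1] at v3
  rw [e2] at v4
  rw [edgeFlux_eq h.self h.rotate.self h.mdet_ne_zero,
    edgeFlux_eq h.self h.rotate.self h.opp.mdet_ne_zero, e1, e2, orient_opposite h.mdet_opp]
  obtain ⟨r1, r2⟩ := jump_relations (b := transVec ξ i j k - transVec ξ i j (T.opp i j k))
    (w := rotVec ξ i j k - rotVec ξ i j (T.opp i j k)) h.self h.rotate.self h.one_add_ne
    (by
      rw [mcross_sub_left]
      refine Eq.trans ?_ (sub_eq_zero.2 (v1.symm.trans v3))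
      abel)
    (by
      rw [mcross_sub_left]
      refine Eq.trans ?_ (sub_eq_zero.2 (v2.symm.trans v4))
      abel)
  rw [minkInner_sub_left, minkInner_sub_left] at r1 r2
  have hp : minkInner i j - 1 ≠ 0 := by linarith [h.lt]
  field_simp
  rw [r1]
  linear_combination (orient i j k * (scale ξ i j k + scale ξ j k i)) * r2

/-- The angular term of the corner `i` of the triangle `ijk`, relative to a reference `s`. -/
noncomputable def cornerTerm (ξ : Mink → Mink) (s : Mink → ℝ) (i j k : Mink) : ℝ :=
  orient i j k * scale ξ i j k * (minkInner (rotVec ξ i j k) i - s i)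

/-- The reference `s` cancels because the two triangles are oppositely oriented. -/
lemma edgeFlux_add_opp_eq (hξ : IsInfDeformation T ξ) (hconf : IsInfConformal T ξ) (s : Mink → ℝ)
    (h : T.IsFlag i j k) : edgeFlux ξ i j k + edgeFlux ξ i j (T.opp i j k) =
      (cornerTerm ξ s i j k - cornerTerm ξ s j k i) +
      (cornerTerm ξ s i j (T.opp i j k) - cornerTerm ξ s j (T.opp i j k) i) := by
  obtain ⟨e1, e2⟩ := scale_opp hξ hconf h
  rw [edgeFlux_add_opp hξ hconf h]
  simp only [cornerTerm, e1, e2, orient_rotate, rotVec_rotate, orient_opposite h.mdet_opp]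
  ring

/-- Rotation speeds are invariant only up to a sign and a shift by the holonomy. Subtracting the
speed of an equivariant reference flag removes the shift, and the orientation sign removes the
other. -/
lemma exists_cornerTerm_invariant (hξ : IsInfDeformation T ξ) : ∃ s : Mink → ℝ,
    ∀ γ ∈ S.Γ, ∀ i j k, T.IsFlag i j k →
      cornerTerm ξ s (γ i) (γ j) (γ k) = cornerTerm ξ s i j k := by
  obtain ⟨p, q, hpq, hγpq⟩ := exists_equivariant_flag T
  refine ⟨fun v => minkInner (rotVec ξ v (p v) (q v)) v, fun γ hγ i j k h => ?_⟩
  obtain ⟨δ, w, hδ, hw⟩ := hξ.rotVec_map hγ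
  obtain ⟨h1, h2⟩ := hw i j k h
  have h3 := (hw i (p i) (q i) (hpq i h.vertex)).2
  obtain ⟨h4, h5⟩ := hγpq γ hγ i h.vertex
  rw [cornerTerm, cornerTerm, h1, h2, hξ.scale_map hγ h, h4, h5, h3]
  linear_combination (orient i j k * scale ξ i j k * (minkInner (rotVec ξ i j k) i -
    minkInner (rotVec ξ i (p i) (q i)) i)) * hδ

lemma edgeWeight_add_opp_nonneg (hT : T.IsDelaunay) (h : T.IsFlag i j k) :
    0 ≤ edgeWeight i j k + edgeWeight i j (T.opp i j k) := by
  rw [edgeWeight_add h.self h.rotate.self h.one_add_ne h.mdet_ne_zero h.opp.mdet_ne_zero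
    h.mdet_opp]
  have h1 : minkInner (T.opp i j k) (circumVec i j k) ≤ -1 := by
    by_contra hn
    refine hT i j k _ h.adjacent ⟨circumVec i j k, minkInner_circumVec h.mdet_ne_zero, ?_, ?_,
      not_le.1 hn⟩
    · rw [← circumVec_rotate]; exact minkInner_circumVec h.rotate.mdet_ne_zero
    · rw [← circumVec_rotate, ← circumVec_rotate]
      exact minkInner_circumVec h.rotate.rotate.mdet_ne_zero
  refine mul_nonneg_of_nonpos_of_nonpos ?_ (by linarith)
  exact div_nonpos_of_nonpos_of_nonneg (by linarith [h.lt]) (by positivity)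

lemma circumVec_opp (h : T.IsFlag i j k)
    (h0 : edgeWeight i j k + edgeWeight i j (T.opp i j k) = 0) :
    circumVec i j (T.opp i j k) = circumVec i j k := by
  rw [edgeWeight_add h.self h.rotate.self h.one_add_ne h.mdet_ne_zero h.opp.mdet_ne_zero
    h.mdet_opp, mul_eq_zero, div_eq_zero_iff] at h0
  have hD := abs_pos.2 h.opp.mdet_ne_zero
  rcases h0 with (h0 | h0) | h0
  · linarith [h.lt]
  · linarith
  · exact (circumVec_eq h.mdet_ne_zero h.opp.mdet_ne_zero (by linarith)).symm

lemma edgeEnergy_nonneg (h : T.IsFlag i j k) : 0 ≤ edgeEnergy ξ i j k := by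
  have : 0 ≤ (1 + minkInner i j) / (minkInner i j - 1) :=
    div_nonneg_of_nonpos (by linarith [h.lt]) (by linarith [h.lt])
  unfold edgeEnergy
  positivity

/-- The coefficient (1 + ⟨i,j⟩)/(⟨i,j⟩ − 1) is tanh²(λ/2) > 0 for an edge of length λ, so the energy
is positive definite. -/
lemma scale_eq_zero_of_edgeEnergy (h : T.IsFlag i j k) (h0 : edgeEnergy ξ i j k = 0) :
    scale ξ i j k = 0 := by
  have h1 : 0 < (1 + minkInner i j) / (minkInner i j - 1) :=
    div_pos_of_neg_of_neg (by linarith [h.lt]) (by linarith [h.lt])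
  unfold edgeEnergy at h0
  have h2 : scale ξ i j k - scale ξ j k i = 0 := by
    have : (scale ξ i j k - scale ξ j k i) ^ 2 = 0 := by
      nlinarith [sq_nonneg (scale ξ i j k - scale ξ j k i),
        mul_nonneg h1.le (sq_nonneg (scale ξ i j k + scale ξ j k i))]
    exact (pow_eq_zero_iff two_ne_zero).1 this
  rw [h2] at h0
  have h3 : scale ξ i j k + scale ξ j k i = 0 := by simpa [h1.ne'] using h0
  linarith

end Basic

/-! ### Vanishing of the energy and of the scale factors; the global isometry. -/

section Rigidity

/-- The energy of the edges vanishes. -/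
lemma weight_mul_energy_eq_zero (hT : T.IsDelaunay) (hξ : IsInfDeformation T ξ)
    (hconf : IsInfConformal T ξ) (h : T.IsFlag i j k) :
    (edgeWeight i j k + edgeWeight i j (T.opp i j k)) * edgeEnergy ξ i j k = 0 := by
  obtain ⟨s, hs⟩ := exists_cornerTerm_invariant hξ
  set r := T.flagSetoid
  set σ := T.oppPerm
  set τ := T.rotatePerm
  have hσ := oppPerm_equivariant (T := T)
  have hτ := rotatePerm_equivariant (T := T)
  set F : T.Flag → ℝ := fun x => edgeFlux ξ x.1.1 x.1.2.1 x.1.2.2 with hF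
  set K : T.Flag → ℝ := fun x => cornerTerm ξ s x.1.1 x.1.2.1 x.1.2.2 with hK
  set Φ : T.Flag → ℝ := fun x =>
    edgeWeight x.1.1 x.1.2.1 x.1.2.2 * edgeEnergy ξ x.1.1 x.1.2.1 x.1.2.2 with hΦ
  have iF : ∀ x y, r x y → F x = F y := by
    rintro x ⟨⟨a, b, c⟩, hy⟩ ⟨γ, hγ, e⟩
    simp only [Prod.mk.injEq] at e
    obtain ⟨rfl, rfl, rfl⟩ := e
    exact (hξ.edgeFlux_map hγ x.2).symm
  have iK : ∀ x y, r x y → K x = K y := by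
    rintro x ⟨⟨a, b, c⟩, hy⟩ ⟨γ, hγ, e⟩
    simp only [Prod.mk.injEq] at e
    obtain ⟨rfl, rfl, rfl⟩ := e
    exact (hs γ hγ _ _ _ x.2).symm
  have iΦ : ∀ x y, r x y → Φ x = Φ y := by
    rintro x ⟨⟨a, b, c⟩, hy⟩ ⟨γ, hγ, e⟩
    simp only [Prod.mk.injEq] at e
    obtain ⟨rfl, rfl, rfl⟩ := e
    simp only [hΦ, edgeWeight_map hγ, hξ.edgeEnergy_map hγ x.2]
  have iKτ : ∀ x y, r x y → K x - K (τ x) = K y - K (τ y) := fun x y hxy => by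
    rw [iK x y hxy, iK _ _ ((hτ x y).1 hxy)]
  -- Summed by edges, the flux is a difference of corner terms, which telescopes under rotation of
  -- the flags.
  have s1 : orbitSum r F + orbitSum r F = 0 := by
    nth_rewrite 2 [← orbitSum_comp r iF σ hσ]
    rw [← orbitSum_add]
    have e : (fun x => F x + F (σ x)) = fun x => (K x - K (τ x)) + (K (σ x) - K (τ (σ x))) :=
      funext fun x => edgeFlux_add_opp_eq hξ hconf s x.2
    rw [e, orbitSum_add, orbitSum_comp r iKτ σ hσ, orbitSum_sub, orbitSum_comp r iK τ hτ]
    ring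
  have s2 : ∀ f : T.Flag → ℝ, (∀ x y, r x y → f x = f y) →
      orbitSum r (fun x => f x + f (τ x) + f (τ (τ x))) = 3 * orbitSum r f := by
    intro f hf
    rw [orbitSum_add, orbitSum_add, orbitSum_comp r hf τ hτ,
      orbitSum_comp r (f := fun x => f (τ x)) (fun x y hxy => hf _ _ ((hτ x y).1 hxy)) τ hτ,
      orbitSum_comp r hf τ hτ]
    ring
  have s3 : orbitSum r Φ = 0 := by
    -- The same total, now grouped by triangles.
    have e : (fun x => F x + F (τ x) + F (τ (τ x))) = fun x => Φ x + Φ (τ x) + Φ (τ (τ x)) := by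
      funext x
      have h1 := x.2.lt
      have h2 := x.2.rotate.lt
      have h3 := x.2.rotate.rotate.lt
      exact edgeFlux_sum (by linarith) (by linarith) (by linarith)
    have := (s2 F iF).symm.trans ((congrArg (orbitSum r) e).trans (s2 Φ iΦ))
    linarith
  have s4 : orbitSum r (fun x => Φ x + Φ (σ x)) = 0 := by
    rw [orbitSum_add, orbitSum_comp r iΦ σ hσ, s3, add_zero]
  have e : ∀ x : T.Flag, Φ x + Φ (σ x) = (edgeWeight x.1.1 x.1.2.1 x.1.2.2 +
      edgeWeight x.1.1 x.1.2.1 (T.opp x.1.1 x.1.2.1 x.1.2.2)) *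
        edgeEnergy ξ x.1.1 x.1.2.1 x.1.2.2 := by
    intro x
    obtain ⟨e1, e2⟩ := scale_opp hξ hconf x.2
    change _ + edgeWeight x.1.1 x.1.2.1 (T.opp x.1.1 x.1.2.1 x.1.2.2) *
      edgeEnergy ξ x.1.1 x.1.2.1 (T.opp x.1.1 x.1.2.1 x.1.2.2) = _
    have : edgeEnergy ξ x.1.1 x.1.2.1 (T.opp x.1.1 x.1.2.1 x.1.2.2) =
        edgeEnergy ξ x.1.1 x.1.2.1 x.1.2.2 := by
      rw [edgeEnergy, edgeEnergy, e1, e2]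
    rw [this, add_mul]
  have := eq_zero_of_orbitSum r (f := fun x => Φ x + Φ (σ x)) (fun x y hxy => by
    rw [iΦ x y hxy, iΦ _ _ ((hσ x y).1 hxy)]) (fun x => by
    rw [e]; exact mul_nonneg (edgeWeight_add_opp_nonneg hT x.2) (edgeEnergy_nonneg x.2)) s4
    ⟨(i, j, k), h⟩
  rw [e] at this
  exact this

/-- The scale factors vanish at every vertex. -/
lemma scale_eq_zero (hT : T.IsDelaunay) (hξ : IsInfDeformation T ξ)
    (hconf : IsInfConformal T ξ) (h : T.IsFlag i j k) : scale ξ i j k = 0 := by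
  classical
  by_contra hne
  set o := circumVec i j k with ho
  set R : Set (Mink × Mink) :=
    {x | T.IsFlag i x.1 x.2 ∧ scale ξ i x.1 x.2 ≠ 0 ∧ circumVec i x.1 x.2 = o} with hR
  have hfin : R.Finite := by
    have hs := finite_star h.vertex
    set B : Finset Mink := hs.toFinset.biUnion id
    refine (B ×ˢ B).finite_toSet.subset ?_
    rintro ⟨a, b⟩ ⟨hab, -⟩
    have hm : ({i, a, b} : Finset Mink) ∈ hs.toFinset := by
      rw [Set.Finite.mem_toFinset]
      exact ⟨hab, by simp⟩
    rw [Finset.mem_coe, Finset.mem_product]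
    exact ⟨Finset.mem_biUnion.2 ⟨_, hm, by simp⟩, Finset.mem_biUnion.2 ⟨_, hm, by simp⟩⟩
  have hne' : R.Nonempty := ⟨(j, k), h, hne, rfl⟩
  -- Since ⟨x−i,x−i⟩ = 2(−1−⟨x,i⟩), this slope is, up to scale, a coordinate of x on the line
  -- obtained from the cycle by inversion at `i`. Take an extreme neighbour `a`.
  obtain ⟨⟨a, b⟩, ⟨hab, hsc, hc⟩, hmax⟩ := Set.exists_max_image R
    (fun x => mdet i o x.1 / (-1 - minkInner x.1 i)) hfin hne'
  simp only at hab hsc hc hmax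
  have hcl := circumVec_opp hab (by
    rcases mul_eq_zero.1 (weight_mul_energy_eq_zero hT hξ hconf hab) with h1 | h1
    · exact h1
    · exact absurd (scale_eq_zero_of_edgeEnergy hab h1) hsc)
  have hb := hmax (b, a) ⟨hab.swap', by rwa [scale_swap], by rwa [circumVec_swap]⟩
  -- The edge from `i` to `a` has zero weight, so the triangle across it stays in `R`.
  have hl := hmax (T.opp i a b, a) ⟨hab.opp.swap', by rwa [scale_swap, (scale_opp hξ hconf hab).1],
    by rw [circumVec_swap, hcl, hc]⟩
  have hNa : 0 < -1 - minkInner a i := by linarith [hab.swap.lt]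
  have hNb : 0 < -1 - minkInner b i := by linarith [hab.rotate.rotate.lt]
  have hNl : 0 < -1 - minkInner (T.opp i a b) i := by linarith [hab.opp.rotate.rotate.lt]
  simp only at hb hl
  rw [div_le_div_iff₀ hNb hNa] at hb
  rw [div_le_div_iff₀ hNl hNa] at hl
  have hio : minkInner i o = -1 := minkInner_circumVec h.mdet_ne_zero
  have hco : ∀ x y, T.IsFlag i x y → circumVec i x y = o → minkInner x o = -1 := by
    intro x y hxy hx
    rw [← hx, ← circumVec_rotate]
    exact minkInner_circumVec hxy.rotate.mdet_ne_zero
  have hao := hco a b hab hc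
  have hbo := hco b a hab.swap' (by rwa [circumVec_swap])
  have hlo := hco _ a hab.opp.swap' (by rw [circumVec_swap, hcl, hc])
  have g1 := mdet_mul_gram i a b o
  have g2 := mdet_mul_gram i a (T.opp i a b) o
  rw [hab.self, hio, hao, hbo] at g1
  rw [hab.self, hio, hao, hlo] at g2
  -- Maximality would put both neighbours of `a` on the same side of the edge `ia`, while they lie
  -- on opposite sides. The way out ⟨o,o⟩ = −1 is the degenerate cycle `o = i`.
  have hC : minkInner o o + 1 = 0 := by
    have hp : 0 ≤ (mdet i a b * (minkInner o o + 1)) *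
        (mdet i a (T.opp i a b) * (minkInner o o + 1)) := by
      refine mul_nonneg_of_nonpos_of_nonpos ?_ ?_ <;> nlinarith
    have hneg := hab.mdet_opp
    by_contra hC
    have : 0 < (minkInner o o + 1) ^ 2 := by positivity
    nlinarith
  have hoi : o = i := by
    rw [← sub_eq_zero]
    refine eq_zero_of_null h.mem ?_ ?_
    · rw [minkInner_sub_left, minkInner_comm, hio, h.self, sub_self]
    · rw [minkInner_sub_left, minkInner_sub_right, minkInner_sub_right, minkInner_comm o i, hio,
        h.self]
      linarith
  rw [hoi] at hao
  linarith

lemma transVec_eq_zero (hT : T.IsDelaunay) (hξ : IsInfDeformation T ξ)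
    (hconf : IsInfConformal T ξ) (h : T.IsFlag i j k) : transVec ξ i j k = 0 := by
  rw [transVec, scale_eq_zero hT hξ hconf h, scale_eq_zero hT hξ hconf h.rotate,
    scale_eq_zero hT hξ hconf h.rotate.rotate]
  simp

lemma velocity_eq_mcross (hT : T.IsDelaunay) (hξ : IsInfDeformation T ξ)
    (hconf : IsInfConformal T ξ) (h : T.IsFlag i j k) : ξ i = mcross (rotVec ξ i j k) i := by
  have := velocity_eq_first hξ h
  rwa [scale_eq_zero hT hξ hconf h, transVec_eq_zero hT hξ hconf h, zero_smul, zero_add,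
    zero_add] at this

lemma eq_zero_of_mcross (hD : mdet i j k ≠ 0) {w : Mink} (hi : mcross w i = 0)
    (hj : mcross w j = 0) : w = 0 := by
  have h := mdet_smul_eq i j k w
  have h1 : mdet w j k = 0 := by rw [mdet, hj]; simp [minkInner]
  have h2 : mdet i w k = 0 := by rw [mdet_swap', mdet, hi]; simp [minkInner]
  have h3 : mdet i j w = 0 := by rw [mdet_rotate w i j, mdet, hi]; simp [minkInner]
  rw [h1, h2, h3] at h
  simpa [hD] using h

theorem IsInfConformal.isTrivialDeformation (hT : T.IsDelaunay) (hξ : IsInfDeformation T ξ)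
    (hconf : IsInfConformal T ξ) : IsTrivialDeformation T ξ := by
  have hv : ∀ {i j k}, T.IsFlag i j k → ∀ v ∈ ({i, j, k} : Finset Mink),
      ξ v = mcross (rotVec ξ i j k) v := by
    intro i j k h v hv
    simp only [Finset.mem_insert, Finset.mem_singleton] at hv
    rcases hv with rfl | rfl | rfl
    · exact velocity_eq_mcross hT hξ hconf h
    · rw [← rotVec_rotate]; exact velocity_eq_mcross hT hξ hconf h.rotate
    · rw [← rotVec_rotate, ← rotVec_rotate]
      exact velocity_eq_mcross hT hξ hconf h.rotate.rotate
  obtain ⟨f₀, hf₀, -⟩ := T.covers _ (hypChart_mem 0)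
  obtain ⟨i₀, j₀, k₀, rfl, h₀⟩ := exists_isFlag hf₀
  refine ⟨mcrossLin (rotVec ξ i₀ j₀ k₀), isInfHypIsometry_mcrossLin _, ?_⟩
  rintro v ⟨f, hf, hvf⟩
  refine face_induction (P := fun f => ∀ v ∈ f, ξ v = mcross (rotVec ξ i₀ j₀ k₀) v) h₀ (hv h₀) ?_
    f hf v hvf
  intro i j k l hk hl hP
  -- An infinitesimal isometry is determined by its values at the two ends of the common edge.
  have hw : rotVec ξ i j l - rotVec ξ i₀ j₀ k₀ = 0 := by
    refine eq_zero_of_mcross hl.mdet_ne_zero ?_ ?_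
    · rw [mcross_sub_left, ← hP i (by simp), ← hv hl i (by simp), sub_self]
    · rw [mcross_sub_left, ← hP j (by simp), ← hv hl j (by simp), sub_self]
  rw [← sub_eq_zero.1 hw]
  exact hv hl

end Rigidity

end HypCircle

theorem mainTheorem6 (S : HypCircle.ClosedHyperbolicSurface)
    (T : HypCircle.GeodesicTriangulation S) (hT : T.IsDelaunay)
    (ξ : HypCircle.Mink → HypCircle.Mink) (hξ : HypCircle.IsInfDeformation T ξ)
    (hconf : HypCircle.IsInfConformal T ξ) : HypCircle.IsTrivialDeformation T ξ :=
  hconf.isTrivialDeformation hT hξ
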